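/- Let $\mathrm{Top}$ be the category of all topological spaces and continuous maps. A morphism $f\colon A\to B$ has the left lifting property with respect to $g\colon C\to D$ (and $g$ has the right lifting property with respect to $f$) if for all $t\colon A\to C$ and $b\colon B\to D$ with $g\circ t=b\circ f$ there is $d\colon B\to C$ with $d\circ f=t$ and $g\circ d=b$. For a class $P$ of morphisms, $P^{l}$ (resp. $P^{r}$) is the class of all morphisms having the left (resp. right) lifting property with respect to every member of $P$; for a word $w=w_1\cdots w_n$ in the letters $l,r$ put $P^{w}=(\cdots(P^{w_1})^{w_2}\cdots)^{w_n}$. Let $P=\{\emptyset\to\{\bullet\}\}$ be the class whose only member is the map from the empty space to the one-point space. Then the orbit $\{P^{w} : w \text{ a nonempty word in } l,r\}$ of iterated orthogonals of $P$ is finite and has exactly $21$ elements. The class $P$ itself is not one of them (so, if the empty word is also allowed, $P$ is one further element). The Schreier graph of the orbit is as follows. The $21$ classes $P^w$ with $$w\in\{l,\ ll,\ lll,\ lr,\ lrr,\ lrrl,\ lrrr,\ lrrrl,\ lrrrr,\ lrrrrr,\ r,\ rl,\ rll,\ rllr,\ rllrr,\ rllrrl,\ rllrrll,\ rr,\ rrr,\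 rrrr,\ rrrrl\}$$ are pairwise distinct and are all the elements of the orbit. Writing $w$ for $P^w$, each of the letters $l$ and $r$ acts on them as follows, where each entry is $w\colon (P^{w})^{l},\ (P^{w})^{r}$: - $l\colon ll,\ lr$; $\quad ll\colon lll,\ lll$; $\quad lll\colon ll,\ ll$; $\quad lr\colon l,\ lrr$; $\quad lrr\colon lrrl,\ lrrr$; $\quad lrrl\colon rll,\ lrr$; - $lrrr\colon lrrrl,\ lrrrr$; $\quad lrrrl\colon rl,\ lrrr$; $\quad lrrrr\colon lrrr,\ lrrrrr$; $\quad lrrrrr\colon lrrrr,\ ll$; - $r\colon rl,\ rr$; $\quad rl\colon rll,\ r$; $\quad rll\colon ll,\ rllr$; $\quad rllr\colon rll,\ rllrr$; $\quad rllrr\colon rllrrl,\ rrrr$; $\quad rllrrl\colon rllrrll,\ rllrr$; $\quad rllrrll\colon ll,\ rllrrl$; - $rr\colon r,\ rrr$; $\quad rrr\colon rr,\ rrrr$; $\quad rrrr\colon rrrrl,\ ll$; $\quad rrrrl\colon rl,\ rrrr$. -/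

import Mathlib

open CategoryTheory

universe u v

namespace QuillenNegation

/-- The two generators of the free monoid acting on classes of morphisms. -/
inductive Letter : Type
  | l : Letter
  | r : Letter

/-- The action of one letter on a class of morphisms: `l` sends `P` to its left orthogonal (the
class of all morphisms having the left lifting property with respect to every member of `P`), and
`r` sends `P` to its right orthogonal. -/
def orth {C : Type u} [Category.{v} C] : Letter → MorphismProperty C → MorphismProperty C
  | Letter.l, P => P.llp
  | Letter.r, P => P.rlp

/-- The class `P ^ w` for a word `w` in `l` and `r`. Words are read from left to right: the class
`P ^ lrr` is `((P ^ l) ^ r) ^ r`. -/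
def act {C : Type u} [Category.{v} C] (P : MorphismProperty C) (w : List Letter) :
    MorphismProperty C :=
  w.foldl (fun Q a => orth a Q) P

/-- The iterated orthogonals of `P`: all classes `P ^ w` where `w` is a nonempty word. -/
def iteratedOrthogonals {C : Type u} [Category.{v} C] (P : MorphismProperty C) :
    Set (MorphismProperty C) :=
  {Q | ∃ w : List Letter, w ≠ [] ∧ Q = act P w}

/-- The map from the empty space to the one-point space. -/
def emptyToPoint : TopCat.of PEmpty.{u + 1} ⟶ TopCat.of PUnit.{u + 1} :=
  TopCat.ofHom ⟨fun x => x.elim, continuous_of_discreteTopology⟩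

/-- The class of morphisms of the category of all topological spaces whose only member is the map
from the empty space to the one-point space. -/
def emptyToPointClass : MorphismProperty TopCat.{u} :=
  MorphismProperty.ofHoms fun _ : Unit => emptyToPoint.{u}

/-- Names for the vertices of the Schreier graph. Each vertex is named by a word leading to it from
the class that consists of the map from the empty space to the one-point space. -/
inductive Vertex : Type
  | l | ll | lll | lr | lrr | lrrl | lrrr | lrrrl | lrrrr | lrrrrr
  | r | rl | rll | rllr | rllrr | rllrrl | rllrrll
  | rr | rrr | rrrr | rrrrl

/-- The word that names a vertex. -/
def Vertex.word : Vertex → List Letter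
  | .l => [.l]
  | .ll => [.l, .l]
  | .lll => [.l, .l, .l]
  | .lr => [.l, .r]
  | .lrr => [.l, .r, .r]
  | .lrrl => [.l, .r, .r, .l]
  | .lrrr => [.l, .r, .r, .r]
  | .lrrrl => [.l, .r, .r, .r, .l]
  | .lrrrr => [.l, .r, .r, .r, .r]
  | .lrrrrr => [.l, .r, .r, .r, .r, .r]
  | .r => [.r]
  | .rl => [.r, .l]
  | .rll => [.r, .l, .l]
  | .rllr => [.r, .l, .l, .r]
  | .rllrr => [.r, .l, .l, .r, .r]
  | .rllrrl => [.r, .l, .l, .r, .r, .l]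
  | .rllrrll => [.r, .l, .l, .r, .r, .l, .l]
  | .rr => [.r, .r]
  | .rrr => [.r, .r, .r]
  | .rrrr => [.r, .r, .r, .r]
  | .rrrrl => [.r, .r, .r, .r, .l]

/-- The end point of the `l`-labelled edge starting at a vertex of the Schreier graph. -/
def Vertex.left : Vertex → Vertex
  | .l => .ll
  | .ll => .lll
  | .lll => .ll
  | .lr => .l
  | .lrr => .lrrl
  | .lrrl => .rll
  | .lrrr => .lrrrl
  | .lrrrl => .rl
  | .lrrrr => .lrrr
  | .lrrrrr => .lrrrr
  | .r => .rl
  | .rl => .rll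
  | .rll => .ll
  | .rllr => .rll
  | .rllrr => .rllrrl
  | .rllrrl => .rllrrll
  | .rllrrll => .ll
  | .rr => .r
  | .rrr => .rr
  | .rrrr => .rrrrl
  | .rrrrl => .rl

/-- The end point of the `r`-labelled edge starting at a vertex of the Schreier graph. -/
def Vertex.right : Vertex → Vertex
  | .l => .lr
  | .ll => .lll
  | .lll => .ll
  | .lr => .lrr
  | .lrr => .lrrr
  | .lrrl => .lrr
  | .lrrr => .lrrrr
  | .lrrrl => .lrrr
  | .lrrrr => .lrrrrr
  | .lrrrrr => .ll
  | .r => .rr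
  | .rl => .r
  | .rll => .rllr
  | .rllr => .rllrr
  | .rllrr => .rrrr
  | .rllrrl => .rllrr
  | .rllrrll => .rllrrl
  | .rr => .rrr
  | .rrr => .rrrr
  | .rrrr => .ll
  | .rrrrl => .rrrr

/-- The class of continuous maps attached to a vertex. -/
def Vertex.toClass (x : Vertex) : MorphismProperty TopCat.{u} :=
  act emptyToPointClass.{u} x.word

end QuillenNegation

/-! Every edge of the graph is an orthogonality computation between concrete classes of maps. All
vertices except `rllr`, `rrr` and `rrrrl` get an explicit description in `Vertex.describe`; those
three stay orthogonals of described classes, and only bounds on them are needed.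

An upper bound for an orthogonal comes from lifting against one or two well-chosen members of the
class: small spaces (two points, discrete or indiscrete, and the Sierpiński space) or a space built
from the map itself, such as its range, `A ⊕ B → B`, or its domain or codomain retopologized. The
opposite bound is a direct construction of lifts, or follows from the Galois connection between
`llp` and `rlp`. Since orthogonals reverse inclusions, a chain of classes whose ends have the same
orthogonal settles everything between; this sandwich recurs throughout. Some remaining edges follow
formally from `llp_rlp_llp` and `rlp_llp_rlp`.

Three edges need a genuine construction: adjoining many isolated points, which forces a generic
section (`clopenDense_rlp_rlp_le_genericallySplit`); an open mapping cylinder, which forces a closed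
embedding (`genericallySplit_llp`); and a resolution of the target whose sections force isolated
points (`t1Fibres_llp_llp_le_discreteExtensions`).

For distinctness, equal classes have equal further orthogonals, so the graph is treated as an
automaton: membership of two Sierpiński test maps after finitely many words separates all 21 states
(`Vertex.eq_of_tests`). -/

open Topology Filter Set

namespace QuillenNegation


/-! ### Lifting problems in terms of points -/

section Lifting

variable {P : MorphismProperty TopCat.{u}}

/-- The lifting property in the category of topological spaces, in terms of functions. -/
theorem hasLiftingProperty_iff {A B X Y : TopCat.{u}} (f : A ⟶ B) (g : X ⟶ Y) :
    HasLiftingProperty f g ↔ ∀ (t : A → X) (b : B → Y), Continuous t → Continuous b →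
      (∀ a, g (t a) = b (f a)) →
        ∃ d : B → X, Continuous d ∧ (∀ a, d (f a) = t a) ∧ ∀ y, g (d y) = b y := by
  constructor
  · intro h t b ht hb comm
    have sq : CommSq (TopCat.ofHom ⟨t, ht⟩) f g (TopCat.ofHom ⟨b, hb⟩) :=
      ⟨by ext a; exact comm a⟩
    have hl := h.sq_hasLift sq
    refine ⟨sq.lift, sq.lift.hom.continuous, fun a => ?_, fun y => ?_⟩
    · exact congrArg (fun k : A ⟶ X => k a) sq.fac_left
    · exact congrArg (fun k : B ⟶ Y => k y) sq.fac_right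
  · intro h
    refine ⟨fun {t b} sq => ?_⟩
    obtain ⟨d, hd, h₁, h₂⟩ := h t b t.hom.continuous b.hom.continuous
      fun a => congrArg (fun k : A ⟶ Y => k a) sq.w
    exact ⟨⟨⟨TopCat.ofHom ⟨d, hd⟩, by ext a; exact h₁ a, by ext y; exact h₂ y⟩⟩⟩

theorem llp_intro {A B : TopCat.{u}} {f : A ⟶ B}
    (h : ∀ (X Y : TopCat.{u}) (g : X ⟶ Y), P g → ∀ (t : A → X) (b : B → Y),
      Continuous t → Continuous b → (∀ a, g (t a) = b (f a)) →
        ∃ d : B → X, Continuous d ∧ (∀ a, d (f a) = t a) ∧ ∀ y, g (d y) = b y) :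
    P.llp f :=
  fun X Y g hg => (hasLiftingProperty_iff f g).2 (h X Y g hg)

theorem rlp_intro {X Y : TopCat.{u}} {g : X ⟶ Y}
    (h : ∀ (A B : TopCat.{u}) (f : A ⟶ B), P f → ∀ (t : A → X) (b : B → Y),
      Continuous t → Continuous b → (∀ a, g (t a) = b (f a)) →
        ∃ d : B → X, Continuous d ∧ (∀ a, d (f a) = t a) ∧ ∀ y, g (d y) = b y) :
    P.rlp g :=
  fun A B f hf => (hasLiftingProperty_iff f g).2 (h A B f hf)

theorem exists_lift_of_llp {A B : TopCat.{u}} {f : A ⟶ B} (hf : P.llp f)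
    {X Y : Type u} [TopologicalSpace X] [TopologicalSpace Y] (g : C(X, Y))
    (hg : P (TopCat.ofHom g)) (t : A → X) (b : B → Y) (ht : Continuous t) (hb : Continuous b)
    (comm : ∀ a, g (t a) = b (f a)) :
    ∃ d : B → X, Continuous d ∧ (∀ a, d (f a) = t a) ∧ ∀ y, g (d y) = b y :=
  (hasLiftingProperty_iff f (TopCat.ofHom g)).1 (hf _ hg) t b ht hb comm

theorem exists_lift_of_rlp {X Y : TopCat.{u}} {g : X ⟶ Y} (hg : P.rlp g)
    {A B : Type u} [TopologicalSpace A] [TopologicalSpace B] (f : C(A, B))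
    (hf : P (TopCat.ofHom f)) (t : A → X) (b : B → Y) (ht : Continuous t) (hb : Continuous b)
    (comm : ∀ a, g (t a) = b (f a)) :
    ∃ d : B → X, Continuous d ∧ (∀ a, d (f a) = t a) ∧ ∀ y, g (d y) = b y :=
  (hasLiftingProperty_iff (TopCat.ofHom f) g).1 (hg _ hf) t b ht hb comm

/-- The lift in the square with identities as horizontal maps is a two-sided inverse. Hence a class
meets its own orthogonals only in isomorphisms. -/
theorem isIso_of_self_lift {A B : TopCat.{u}} (f : A ⟶ B) (h : HasLiftingProperty f f) :
    IsIso f := by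
  have sq : CommSq (𝟙 A) f f (𝟙 B) := ⟨by simp⟩
  have := h.sq_hasLift sq
  exact ⟨sq.lift, sq.fac_left, sq.fac_right⟩

end Lifting

/-! ### Topological tools and test spaces -/

section Topology

variable {A B X Y : Type u} [TopologicalSpace A] [TopologicalSpace B] [TopologicalSpace X]
  [TopologicalSpace Y]

theorem exists_continuous_factor {f : A → B} (hf : IsQuotientMap f) {t : A → X}
    (ht : Continuous t) (h : ∀ a a', f a = f a' → t a = t a') :
    ∃ d : B → X, Continuous d ∧ ∀ a, d (f a) = t a := by
  have hd : ∀ a, (t ∘ Function.surjInv hf.surjective) (f a) = t a := fun a =>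
    h _ _ (Function.surjInv_eq hf.surjective (f a))
  refine ⟨_, ?_, hd⟩
  rw [hf.continuous_iff]
  exact ht.congr fun a => (hd a).symm

theorem exists_continuous_factor_embedding {g : X → Y} (hg : IsEmbedding g) {b : B → Y}
    (hb : Continuous b) (h : ∀ y, b y ∈ range g) :
    ∃ d : B → X, Continuous d ∧ ∀ y, g (d y) = b y := by
  choose d hd using h
  refine ⟨d, ?_, hd⟩
  rw [hg.continuous_iff]
  exact hb.congr fun y => (hd y).symm

/-- A clopen range lets continuity be checked separately on the range and on its complement. -/
theorem continuous_extend {f : A → B} (hf : IsOpenEmbedding f) (hc : IsClosed (range f))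
    {t : A → X} (ht : Continuous t) {e : B → X} (he : ∀ y ∉ range f, ContinuousAt e y) :
    Continuous (Function.extend f t e) := by
  rw [continuous_iff_continuousAt]
  intro y
  by_cases hy : y ∈ range f
  · obtain ⟨a, rfl⟩ := hy
    rw [← hf.continuousAt_iff]
    exact (ht.congr fun a => (hf.injective.extend_apply t e a).symm).continuousAt
  · refine (he y hy).congr ?_
    filter_upwards [hc.isOpen_compl.mem_nhds hy] with z hz
    exact (Function.extend_apply' t e z fun ⟨a, ha⟩ => hz ⟨a, ha⟩).symm

/-- The hypotheses make the range of `f` the preimage under `d` of the clopen summand `A`, while `d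
∘ f = inl` makes `f` an embedding. -/
theorem isClopenEmbedding_of_sum_lift {f : A → B} (hf : Continuous f) {d : B → A ⊕ X}
    (hd : Continuous d) (hdf : ∀ a, d (f a) = Sum.inl a)
    (h : ∀ y a, d y = Sum.inl a → y = f a) :
    IsOpenEmbedding f ∧ IsClosed (range f) := by
  have he : IsEmbedding f := by
    refine IsEmbedding.of_comp hf hd ?_
    have : d ∘ f = Sum.inl := funext hdf
    rw [this]
    exact IsEmbedding.inl
  have hr : range f = d ⁻¹' range Sum.inl := by
    ext y
    constructor
    · rintro ⟨a, rfl⟩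
      exact ⟨a, (hdf a).symm⟩
    · rintro ⟨a, ha⟩
      exact ⟨a, (h y a ha.symm).symm⟩
  refine ⟨⟨he, ?_⟩, ?_⟩
  · rw [hr]
    exact isOpen_range_inl.preimage hd
  · rw [hr]
    exact isClosed_range_inl.preimage hd

theorem isOpen_setOf_mem_sUnion {Z : Type u} (i : X → Z) {S : Set (Set Z)}
    (h : ∀ W ∈ S, IsOpen {x | i x ∈ W}) : IsOpen {x | i x ∈ ⋃₀ S} := by
  have : {x | i x ∈ ⋃₀ S} = ⋃ W ∈ S, {x | i x ∈ W} := by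
    ext x
    simp
  rw [this]
  exact isOpen_biUnion h

/-- A set with the indiscrete topology. -/
def Indisc (X : Type u) : Type u := X

instance (X : Type u) : TopologicalSpace (Indisc X) := ⊤

/-- A set with the discrete topology. -/
def Disc (X : Type u) : Type u := X

instance (X : Type u) : TopologicalSpace (Disc X) := ⊥

instance (X : Type u) : DiscreteTopology (Disc X) := ⟨rfl⟩

/-- The codomain of a function, with the coinduced topology. -/
def Coinduced (_ : A → Y) : Type u := Y

instance (f : A → Y) : TopologicalSpace (Coinduced f) := .coinduced f inferInstance

/-- The domain of a function, with the induced topology. -/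
def Induced (_ : X → Y) : Type u := X

instance (f : X → Y) : TopologicalSpace (Induced f) := .induced f inferInstance

/-- The Sierpiński space, with open point `True`. -/
abbrev Sierp : Type u := ULift.{u} Prop

theorem continuous_sierp {p : X → Prop} (hp : IsOpen {x | p x}) :
    Continuous fun x => (⟨p x⟩ : Sierp.{u}) :=
  continuous_uliftUp.comp (continuous_Prop.2 hp)

theorem isOpen_sierp {d : X → Sierp.{u}} (hd : Continuous d) : IsOpen {x | (d x).down} :=
  continuous_Prop.1 (continuous_uliftDown.comp hd)

/-- A specialization is the same as a map from the Sierpiński space; the open point goes to the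
generization `x`. -/
theorem continuous_of_specializes {x y : X} (h : x ⤳ y) :
    Continuous fun p : Sierp.{u} => open Classical in if p.down then x else y := by
  classical
  rw [continuous_def]
  intro U hU
  by_cases hy : y ∈ U
  · have hx : x ∈ U := h.mem_open hU hy
    convert isOpen_univ
    ext p
    by_cases hp : p.down <;> simp [hp, hx, hy]
  · by_cases hx : x ∈ U
    · convert isOpen_sierp (continuous_id (X := Sierp.{u}))
      ext p
      by_cases hp : p.down <;> simp [hp, hx, hy]
    · convert isOpen_empty
      ext p
      by_cases hp : p.down <;> simp [hp, hx, hy]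

theorem continuous_of_inseparable {x y : X} (h : Inseparable x y) :
    Continuous fun p : Indisc (ULift.{u} Bool) => if p.down then x else y := by
  rw [continuous_def]
  intro U hU
  have hxy := h.mem_open_iff hU
  by_cases hy : y ∈ U
  · convert isOpen_univ
    ext p
    by_cases hp : p.down <;> simp [hp, hxy, hy]
  · convert isOpen_empty
    ext p
    by_cases hp : p.down <;> simp [hp, hxy, hy]

/-- The map to the one-point space. -/
def toPoint (X : Type u) [TopologicalSpace X] : C(X, PUnit.{u + 1}) :=
  ⟨fun _ => PUnit.unit, continuous_const⟩

/-- Take `K` of regular cardinality, the successor of `max #X ℵ₀`, with the cocardinal filter. By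
pigeonhole every `K → X` has a fibre of full size, whose complement is therefore not in the filter.
-/
theorem exists_free_filter (X : Type u) :
    ∃ (K : Type u) (F : Filter K), (∀ k, ∀ᶠ k' in F, k' ≠ k) ∧
      ∀ r : K → X, ∃ c, ∃ᶠ k in F, r k = c := by
  set c : Cardinal.{u} := max (Cardinal.mk X) Cardinal.aleph0
  have hc : (Order.succ c).IsRegular := Cardinal.isRegular_succ (le_max_right _ _)
  have hlt : c < Order.succ c := Order.lt_succ c
  refine ⟨(Order.succ c).out, Filter.cocardinal _ hc, fun k => ?_, fun r => ?_⟩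
  · rw [Filter.Eventually, Filter.mem_cocardinal]
    refine lt_of_lt_of_le ?_ hc.aleph0_le
    have : {k' | k' ≠ k}ᶜ = {k} := by ext; simp
    rw [this, Cardinal.mk_singleton]
    exact Cardinal.one_lt_aleph0
  · obtain ⟨a, ha⟩ := Cardinal.infinite_pigeonhole_card r (Order.succ c) (by simp) hc.aleph0_le
      (by rw [hc.cof_ord]; exact lt_of_le_of_lt (le_max_left _ _) hlt)
    refine ⟨a, fun h => ?_⟩
    rw [Filter.Eventually, Filter.mem_cocardinal] at h
    refine absurd (lt_of_le_of_lt ha ?_) (lt_irrefl _)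
    convert h using 3
    ext k
    simp

end Topology


/-! ### The classes occurring in the orbit -/

section Classes

/-- The continuous maps whose source is nonempty unless their target is empty. -/
def nonemptySource : MorphismProperty TopCat.{u} := fun A B _ => Nonempty B → Nonempty A

/-- The homeomorphisms. -/
def homeos : MorphismProperty TopCat.{u} := MorphismProperty.isomorphisms TopCat.{u}

/-- The homeomorphisms and the maps with empty source. -/
def emptySourceOrIso : MorphismProperty TopCat.{u} := fun A _ f => IsEmpty A ∨ IsIso f

/-- The maps that have a continuous section. -/
def split : MorphismProperty TopCat.{u} := fun A B f =>
  ∃ s : B → A, Continuous s ∧ ∀ y, f (s y) = y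

/-- The embeddings onto open and closed subspaces. -/
def clopenEmbeddings : MorphismProperty TopCat.{u} := fun _ _ f =>
  IsOpenEmbedding f ∧ IsClosed (range f)

/-- The open embeddings with discrete complement. -/
def discreteExtensions : MorphismProperty TopCat.{u} := fun _ _ f =>
  IsOpenEmbedding f ∧ ∀ y ∉ range f, IsOpen {y}

/-- The injective continuous maps. -/
def injections : MorphismProperty TopCat.{u} := fun _ _ f => Function.Injective f

/-- The surjective continuous maps. -/
def surjections : MorphismProperty TopCat.{u} := fun _ _ f => Function.Surjective f

/-- The quotient maps. -/
def quotients : MorphismProperty TopCat.{u} := fun _ _ f => IsQuotientMap f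

/-- The surjective maps whose source carries the induced topology. -/
def inducingSurjections : MorphismProperty TopCat.{u} := fun _ _ f =>
  Function.Surjective f ∧ IsInducing f

/-- The maps with fibres that are Kolmogorov spaces. -/
def t0Fibres : MorphismProperty TopCat.{u} := fun _ _ f =>
  ∀ x y, f x = f y → Inseparable x y → x = y

/-- The maps with fibres that are T1 spaces. -/
def t1Fibres : MorphismProperty TopCat.{u} := fun _ _ f =>
  ∀ x y, f x = f y → x ⤳ y → x = y

/-- The maps whose image meets every nonempty clopen set. -/
def clopenDense : MorphismProperty TopCat.{u} := fun A B f =>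
  ∀ U : Set B, IsClopen U → (∀ a : A, f a ∉ U) → U = ∅

/-- The maps with dense image. -/
def dense : MorphismProperty TopCat.{u} := fun _ _ f => DenseRange f

/-- The embeddings. -/
def embeddings : MorphismProperty TopCat.{u} := fun _ _ f => IsEmbedding f

/-- The closed embeddings. -/
def closedEmbeddings : MorphismProperty TopCat.{u} := fun _ _ f => IsClosedEmbedding f

/-- The maps with a continuous section that picks a generic point of each fibre. -/
def genericallySplit : MorphismProperty TopCat.{u} := fun A B f =>
  ∃ s : B → A, Continuous s ∧ (∀ y, f (s y) = y) ∧ ∀ x, s (f x) ⤳ x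

end Classes

/-! ### Empty sources, sections, clopen embeddings -/

section Basic

theorem isIso_of_isEmbedding {A B : TopCat.{u}} {f : A ⟶ B} (h : IsEmbedding f)
    (hs : Function.Surjective f) : IsIso f :=
  (TopCat.isIso_iff_isHomeomorph f).2 (isHomeomorph_iff_isEmbedding_surjective.2 ⟨h, hs⟩)

theorem homeos_le_llp (P : MorphismProperty TopCat.{u}) : homeos ≤ P.llp :=
  fun _ _ f hf => by
    have : IsIso f := hf
    exact MorphismProperty.llp_of_isIso P f

theorem homeos_le_rlp (P : MorphismProperty TopCat.{u}) : homeos ≤ P.rlp :=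
  fun _ _ f hf => by
    have : IsIso f := hf
    exact MorphismProperty.rlp_of_isIso P f

theorem homeos_llp : homeos.{u}.llp = ⊤ :=
  top_le_iff.1 ((MorphismProperty.le_llp_iff_le_rlp _ _).2 (homeos_le_rlp _))

theorem homeos_rlp : homeos.{u}.rlp = ⊤ :=
  top_le_iff.1 ((MorphismProperty.le_llp_iff_le_rlp _ _).1 (homeos_le_llp _))

theorem top_llp : (⊤ : MorphismProperty TopCat.{u}).llp = homeos :=
  le_antisymm (fun _ _ f hf => isIso_of_self_lift f (hf f trivial)) (homeos_le_llp _)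

theorem top_rlp : (⊤ : MorphismProperty TopCat.{u}).rlp = homeos :=
  le_antisymm (fun _ _ f hf => isIso_of_self_lift f (hf f trivial)) (homeos_le_rlp _)

theorem emptyToPointClass_llp : emptyToPointClass.{u}.llp = nonemptySource := by
  ext A B f
  rw [emptyToPointClass, MorphismProperty.llp_ofHoms_iff_hasLiftingProperty,
    hasLiftingProperty_iff]
  constructor
  · intro h ⟨y⟩
    by_contra hA
    rw [not_nonempty_iff] at hA
    obtain ⟨d, -⟩ := h (fun a => hA.elim a) (fun _ => PUnit.unit)
      (continuous_of_const fun a => hA.elim a) continuous_const (fun a => hA.elim a)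
    exact (d y).elim
  · intro h t b ht hb _
    have hA : IsEmpty A := ⟨fun a => (t a).elim⟩
    have hB : IsEmpty B := ⟨fun y => hA.elim (h ⟨y⟩).some⟩
    exact ⟨fun y => hB.elim y, continuous_of_const fun y => hB.elim y, fun a => hA.elim a,
      fun y => hB.elim y⟩

theorem emptyToPointClass_rlp : emptyToPointClass.{u}.rlp = surjections := by
  ext X Y g
  rw [emptyToPointClass, MorphismProperty.rlp_ofHoms_iff_hasLiftingProperty,
    hasLiftingProperty_iff]
  constructor
  · intro h y
    obtain ⟨d, -, -, hd⟩ := h (fun a => a.elim) (fun _ => y)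
      (continuous_of_const fun a => a.elim) continuous_const (fun a => a.elim)
    exact ⟨_, hd PUnit.unit⟩
  · intro h t b _ _ _
    obtain ⟨x, hx⟩ := h (b PUnit.unit)
    exact ⟨fun _ => x, continuous_const, fun a => a.elim, fun _ => hx⟩

/-- A map in the class lifts against itself. The only other case, empty source and nonempty target,
is excluded by lifting against a point of a two-point discrete space, with the bottom map constant
at the other point. -/
theorem nonemptySource_llp : nonemptySource.{u}.llp = homeos := by
  refine le_antisymm (fun A B f hf => ?_) (homeos_le_llp _)
  refine isIso_of_self_lift f (hf f fun ⟨y⟩ => ?_)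
  by_contra hA
  rw [not_nonempty_iff] at hA
  obtain ⟨d, -, -, hd⟩ := exists_lift_of_llp hf
    (⟨fun _ => ⟨false⟩, continuous_const⟩ : C(PUnit.{u + 1}, ULift.{u} Bool))
    (fun _ => ⟨PUnit.unit⟩) (fun a => hA.elim a) (fun _ => ⟨true⟩)
    (continuous_of_const fun a => hA.elim a) continuous_const (fun a => hA.elim a)
  exact absurd (congrArg ULift.down (hd y)) (by simp)

theorem nonemptySource_rlp : nonemptySource.{u}.rlp = emptySourceOrIso := by
  refine le_antisymm (fun X Y g hg => ?_) (fun X Y g hg => ?_)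
  · rcases isEmpty_or_nonempty X with h | h
    · exact Or.inl h
    · exact Or.inr (isIso_of_self_lift g (hg g fun _ => h))
  · rcases hg with h | h
    · refine rlp_intro fun A B f hf t b _ _ _ => ?_
      have hB : IsEmpty B := ⟨fun y => h.elim (t (hf ⟨y⟩).some)⟩
      exact ⟨fun y => hB.elim y, continuous_of_const fun y => hB.elim y,
        fun a => hB.elim (f a), fun y => hB.elim y⟩
    · exact homeos_le_rlp _ g h

theorem emptySourceOrIso_rlp : emptySourceOrIso.{u}.rlp = split := by
  refine le_antisymm (fun X Y g hg => ?_) (fun X Y g hg => ?_)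
  · obtain ⟨d, hd, -, h⟩ := exists_lift_of_rlp hg
      (⟨fun a => a.elim, continuous_of_const fun a => a.elim⟩ : C(PEmpty.{u + 1}, Y))
      (Or.inl ⟨fun a => a.elim⟩) (fun a => a.elim) id (continuous_of_const fun a => a.elim)
      continuous_id (fun a => a.elim)
    exact ⟨d, hd, h⟩
  · obtain ⟨s, hs, h⟩ := hg
    intro A B f hf
    rcases hf with hf | hf
    · rw [hasLiftingProperty_iff]
      exact fun t b _ hb _ => ⟨s ∘ b, hs.comp hb, fun a => hf.elim a, fun y => h _⟩
    · infer_instance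

/-- The test map is `(f, id) : A ⊕ B → B`, which is split by the second summand. -/
theorem split_llp : split.{u}.llp = clopenEmbeddings := by
  refine le_antisymm (fun A B f hf => ?_) (fun A B f hf => ?_)
  · obtain ⟨d, hd, h₁, h₂⟩ := exists_lift_of_llp hf
      (⟨Sum.elim f id, f.hom.continuous.sumElim continuous_id⟩ : C(A ⊕ B, B))
      ⟨Sum.inr, continuous_inr, fun _ => rfl⟩ Sum.inl id continuous_inl continuous_id
      (fun _ => rfl)
    exact isClopenEmbedding_of_sum_lift f.hom.continuous hd h₁
      fun y a e => by simpa [e] using (h₂ y).symm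
  · refine llp_intro fun X Y g ⟨s, hs, h⟩ t b ht hb comm => ?_
    refine ⟨_, continuous_extend hf.1 hf.2 ht (e := s ∘ b)
      fun y _ => (hs.comp hb).continuousAt, hf.1.injective.extend_apply t _, fun y => ?_⟩
    by_cases hy : y ∈ range f
    · obtain ⟨a, rfl⟩ := hy
      rw [hf.1.injective.extend_apply, comm]
    · rw [Function.extend_apply' _ _ _ fun ⟨a, ha⟩ => hy ⟨a, ha⟩]
      exact h _

theorem discreteExtensions_isClosed {A B : TopCat.{u}} {f : A ⟶ B} (hf : discreteExtensions f) :
    IsClosed (range f) := by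
  rw [← isOpen_compl_iff, ← biUnion_of_singleton (range f)ᶜ]
  exact isOpen_biUnion hf.2

/-- As for split maps, but with the second copy of `B` made discrete: the test map remains
surjective, and the lift now carries the complement of the range into a discrete space. -/
theorem surjections_llp : surjections.{u}.llp = discreteExtensions := by
  refine le_antisymm (fun A B f hf => ?_) (fun A B f hf => ?_)
  · obtain ⟨d, hd, h₁, h₂⟩ := exists_lift_of_llp hf
      (⟨Sum.elim f (fun y : Disc B => y),
        f.hom.continuous.sumElim continuous_of_discreteTopology⟩ : C(A ⊕ Disc B, B))
      (fun y => ⟨Sum.inr y, rfl⟩) Sum.inl id continuous_inl continuous_id (fun _ => rfl)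
    refine ⟨(isClopenEmbedding_of_sum_lift f.hom.continuous hd h₁
      fun y a e => (h₂ y).symm.trans (by rw [e]; rfl)).1, fun y hy => ?_⟩
    have hdy : ∃ z, d y = Sum.inr z := by
      rcases e : d y with a | z
      · exact absurd ⟨a, .trans (by rw [e]; rfl) (h₂ y)⟩ hy
      · exact ⟨z, rfl⟩
    obtain ⟨z, hz⟩ := hdy
    have : {y} = d ⁻¹' (Sum.inr '' {z}) := by
      ext w
      simp only [mem_singleton_iff, image_singleton, mem_preimage]
      constructor
      · rintro rfl
        exact hz
      · intro hw
        exact (h₂ w).symm.trans (.trans (by rw [hw, hz]) (h₂ y))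
    rw [this]
    exact (isOpenMap_inr _ (isOpen_discrete _)).preimage hd
  · refine llp_intro fun X Y g hg t b ht hb comm => ?_
    refine ⟨_, continuous_extend hf.1 (discreteExtensions_isClosed hf) ht
      (e := Function.surjInv hg ∘ b) fun y hy => ?_, hf.1.injective.extend_apply t _, fun y => ?_⟩
    · rw [ContinuousAt, (isOpen_singleton_iff_nhds_eq_pure y).1 (hf.2 y hy)]
      exact tendsto_pure_nhds _ _
    · by_cases hy : y ∈ range f
      · obtain ⟨a, rfl⟩ := hy
        rw [hf.1.injective.extend_apply, comm]
      · rw [Function.extend_apply' _ _ _ fun ⟨a, ha⟩ => hy ⟨a, ha⟩]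
        exact Function.surjInv_eq hg _

theorem discreteExtensions_le_clopenEmbeddings :
    discreteExtensions.{u} ≤ clopenEmbeddings :=
  fun _ _ _ hf => ⟨hf.1, discreteExtensions_isClosed hf⟩

/-- The part of `B` that `b` sends outside the clopen image of `g` is clopen and misses the image of
`f`, so it is empty. -/
theorem clopenDense_le_clopenEmbeddings_llp : clopenDense.{u} ≤ clopenEmbeddings.llp := by
  refine fun A B f hf => llp_intro fun X Y g hg t b ht hb comm => ?_
  have h : (b ⁻¹' range g)ᶜ = ∅ := hf _
    (IsClopen.compl ⟨hg.2.preimage hb, hg.1.isOpen_range.preimage hb⟩) fun a ha => ha ⟨t a, comm a⟩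
  obtain ⟨d, hd, hgd⟩ := exists_continuous_factor_embedding hg.1.isEmbedding hb
    fun y => (compl_empty_iff.1 h ▸ mem_univ y : y ∈ b ⁻¹' range g)
  exact ⟨d, hd, fun a => hg.1.injective ((hgd _).trans (comm a).symm), hgd⟩

/-- A clopen set is a map to two points; if it misses the image of `f`, lifting against the
inclusion of one point makes it empty. -/
theorem discreteExtensions_llp_le_clopenDense : discreteExtensions.{u}.llp ≤ clopenDense := by
  classical
  intro A B f hf U hU h
  have hb : Continuous fun y : B => (⟨decide (y ∈ U)⟩ : ULift.{u} Bool) := by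
    refine continuous_uliftUp.comp ?_
    exact (continuous_bool_rng true).2 (by convert hU; ext; simp)
  let g : C(PUnit.{u + 1}, ULift.{u} Bool) := ⟨fun _ => ⟨false⟩, continuous_const⟩
  have hg : discreteExtensions (TopCat.ofHom g) :=
    ⟨.of_continuous_injective_isOpenMap continuous_const (fun _ _ _ => rfl)
      fun _ _ => isOpen_discrete _, fun _ _ => isOpen_discrete _⟩
  obtain ⟨d, -, -, hd⟩ := exists_lift_of_llp hf g hg
    (fun _ => PUnit.unit) _ continuous_const hb (fun a => by simp [h a, g])
  ext y
  simpa [g] using congrArg ULift.down (hd y)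

theorem clopenEmbeddings_llp : clopenEmbeddings.{u}.llp = clopenDense :=
  le_antisymm ((MorphismProperty.antitone_llp discreteExtensions_le_clopenEmbeddings).trans
    discreteExtensions_llp_le_clopenDense) clopenDense_le_clopenEmbeddings_llp

theorem discreteExtensions_llp : discreteExtensions.{u}.llp = clopenDense :=
  le_antisymm discreteExtensions_llp_le_clopenDense
    (clopenDense_le_clopenEmbeddings_llp.trans
      (MorphismProperty.antitone_llp discreteExtensions_le_clopenEmbeddings))

end Basic


/-! ### Injections, quotients and T0 fibres -/

section Quotients

theorem injections_le_split_rlp : injections.{u} ≤ split.rlp := by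
  refine fun X Y g hg => rlp_intro fun A B f ⟨s, hs, h⟩ t b ht hb comm => ?_
  have hd : ∀ y, g (t (s y)) = b y := fun y => by rw [comm, h]
  exact ⟨t ∘ s, ht.comp hs, fun a => hg ((hd _).trans (comm a).symm), hd⟩

theorem split_rlp : split.{u}.rlp = injections := by
  refine le_antisymm (fun X Y g hg x x' e => ?_) injections_le_split_rlp
  obtain ⟨d, -, hd, -⟩ := exists_lift_of_rlp hg (toPoint (ULift.{u} Bool))
    ⟨fun _ => ⟨true⟩, continuous_const, fun _ => rfl⟩ (fun i => if i.down then x else x')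
    (fun _ => g x) continuous_of_discreteTopology continuous_const
    (fun i => by by_cases h : i.down <;> simp [h, e])
  exact (hd ⟨true⟩).symm.trans (hd ⟨false⟩)

/-- Two injections into `B` serve as tests: `B` with the topology coinduced by `f`, and the range of
`f`. -/
theorem injections_llp : injections.{u}.llp = quotients := by
  refine le_antisymm (fun A B f hf => ?_) (fun A B f hf => ?_)
  · refine (isQuotientMap_iff _).2 ⟨isCoinducing_iff.2 fun U => ⟨fun h => ?_,
      fun h => h.preimage f.hom.continuous⟩, fun y => ?_⟩
    · obtain ⟨d, hd, -, h₂⟩ := exists_lift_of_llp hf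
        (⟨fun y => y, continuous_iff_coinduced_le.2 f.hom.continuous.coinduced_le⟩ :
          C(Coinduced f, B)) (fun _ _ e => e) f id continuous_coinduced_rng continuous_id
        (fun _ => rfl)
      have hU : IsOpen (X := Coinduced f) U := isOpen_coinduced.2 h
      have hdU := hU.preimage hd
      rwa [show d = id from funext h₂] at hdU
    · obtain ⟨d, -, -, h₂⟩ := exists_lift_of_llp hf
        (⟨Subtype.val, continuous_subtype_val⟩ : C(range f, B)) Subtype.val_injective
        (fun a => ⟨f a, a, rfl⟩) id (f.hom.continuous.subtype_mk _) continuous_id (fun _ => rfl)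
      obtain ⟨a, ha⟩ := (d y).2
      exact ⟨a, ha.trans (h₂ y)⟩
  · refine llp_intro fun X Y g hg t b ht hb comm => ?_
    obtain ⟨d, hd, h⟩ := exists_continuous_factor hf ht
      fun a a' e => hg (by rw [comm, comm, e])
    refine ⟨d, hd, h, fun y => ?_⟩
    obtain ⟨a, rfl⟩ := hf.surjective y
    rw [h, comm]

/-- The test that detects the topology is the identity of `X` onto `X` with the topology induced by
`g`. Conversely, any set-theoretic lift into an induced topology is continuous. -/
theorem injections_rlp : injections.{u}.rlp = inducingSurjections := by
  refine le_antisymm (fun X Y g hg => ?_) (fun X Y g hg => ?_)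
  · refine ⟨fun y => ?_, ?_⟩
    · obtain ⟨d, -, -, h⟩ := exists_lift_of_rlp hg
        (⟨fun a => a.elim, continuous_of_const fun a => a.elim⟩ : C(PEmpty.{u + 1}, PUnit.{u + 1}))
        (fun a => a.elim) (fun a => a.elim) (fun _ => y) (continuous_of_const fun a => a.elim)
        continuous_const (fun a => a.elim)
      exact ⟨_, h PUnit.unit⟩
    · obtain ⟨d, hd, h₁, -⟩ := exists_lift_of_rlp hg
        (⟨fun x => x, continuous_induced_rng.2 g.hom.continuous⟩ : C(X, Induced g))
        (fun _ _ e => e) id g continuous_id continuous_induced_dom (fun _ => rfl)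
      refine ⟨le_antisymm (continuous_iff_le_induced.1 g.hom.continuous) ?_⟩
      have hid : (fun x : Induced g => (x : X)) = d := funext fun x => (h₁ x).symm
      rw [← hid] at hd
      exact continuous_id_iff_le.1 hd
  · refine rlp_intro fun A B f hf t b ht hb comm => ?_
    have hd : ∀ y, g (Function.extend f t (Function.surjInv hg.1 ∘ b) y) = b y := fun y => by
      by_cases hy : y ∈ range f
      · obtain ⟨a, rfl⟩ := hy
        rw [Function.Injective.extend_apply hf, comm]
      · rw [Function.extend_apply' _ _ _ fun ⟨a, ha⟩ => hy ⟨a, ha⟩]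
        exact Function.surjInv_eq hg.1 _
    exact ⟨_, hg.2.continuous_iff.2 (hb.congr fun y => (hd y).symm),
      Function.Injective.extend_apply hf t _, hd⟩

theorem isInducing_toPoint_indisc (X : Type u) : IsInducing (toPoint (Indisc X)) :=
  ⟨(induced_const (t := (inferInstance : TopologicalSpace PUnit.{u + 1}))
    (x := PUnit.unit)).symm⟩

theorem inducingSurjections_llp : inducingSurjections.{u}.llp = injections := by
  refine le_antisymm (fun A B f hf a a' e => ?_) ?_
  · obtain ⟨d, -, hd, -⟩ := exists_lift_of_llp hf (toPoint (Indisc A))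
      ⟨fun _ => ⟨a, rfl⟩, isInducing_toPoint_indisc _⟩ id (fun _ => PUnit.unit)
      continuous_top continuous_const (fun _ => rfl)
    exact (hd a).symm.trans ((congrArg d e).trans (hd a'))
  · rw [MorphismProperty.le_llp_iff_le_rlp, injections_rlp]

theorem inducingSurjections_rlp : inducingSurjections.{u}.rlp = t0Fibres := by
  refine le_antisymm (fun X Y g hg x x' e h => ?_) (fun X Y g hg => ?_)
  · obtain ⟨d, -, hd, -⟩ := exists_lift_of_rlp hg (toPoint (Indisc (ULift.{u} Bool)))
      ⟨fun _ => ⟨⟨true⟩, rfl⟩, isInducing_toPoint_indisc _⟩ _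
      (fun _ => g x) (continuous_of_inseparable h) continuous_const
      (fun i => by by_cases h : i.down <;> simp [h, e])
    exact (hd ⟨true⟩).symm.trans (hd ⟨false⟩)
  · refine rlp_intro fun A B f hf t b ht hb comm => ?_
    obtain ⟨d, hd, h⟩ := exists_continuous_factor (hf.2.isQuotientMap_of_surjective hf.1) ht
      fun a a' e => hg _ _ (by rw [comm, comm, e])
        ((hf.2.inseparable_iff.1 (by rw [e])).map ht)
    refine ⟨d, hd, h, fun y => ?_⟩
    obtain ⟨a, rfl⟩ := hf.1 y
    rw [h, comm]

theorem injections_le_t1Fibres : injections.{u} ≤ t1Fibres :=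
  fun _ _ _ hf _ _ e _ => hf e

theorem t1Fibres_le_t0Fibres : t1Fibres.{u} ≤ t0Fibres :=
  fun _ _ _ hf x y e h => hf x y e h.specializes

/-- Lifting against `B × SeparationQuotient A → B`, whose fibres are T0, factors the inducing map `A
→ SeparationQuotient A` through `f`, so `f` is inducing. -/
theorem t0Fibres_llp : t0Fibres.{u}.llp = inducingSurjections := by
  refine le_antisymm (fun A B f hf => ?_) ?_
  · refine ⟨?_, ?_⟩
    · have := MorphismProperty.antitone_llp (injections_le_t1Fibres.trans t1Fibres_le_t0Fibres) f hf
      rw [injections_llp] at this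
      exact IsQuotientMap.surjective this
    · obtain ⟨d, hd, h, -⟩ := exists_lift_of_llp hf
        (⟨Prod.fst, continuous_fst⟩ : C(B × SeparationQuotient A, B))
        (fun x y e hxy => Prod.ext e (hxy.map continuous_snd).eq)
        (fun a => (f a, SeparationQuotient.mk a)) id
        (f.hom.continuous.prodMk SeparationQuotient.continuous_mk) continuous_id (fun _ => rfl)
      refine IsInducing.of_comp f.hom.continuous (continuous_snd.comp hd) ?_
      rw [show (Prod.snd ∘ d) ∘ f = SeparationQuotient.mk from
        funext fun a => congrArg Prod.snd (h a)]
      exact SeparationQuotient.isInducing_mk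
  · rw [MorphismProperty.le_llp_iff_le_rlp, inducingSurjections_rlp]

theorem t1Fibres_rlp_le_homeos : t1Fibres.{u}.rlp ≤ homeos := by
  intro X Y g hg
  have h := MorphismProperty.antitone_rlp injections_le_t1Fibres g hg
  rw [injections_rlp] at h
  refine isIso_of_isEmbedding ⟨h.2, fun x x' e => ?_⟩ h.1
  obtain ⟨d, -, hd, -⟩ := exists_lift_of_rlp hg (toPoint (ULift.{u} Bool))
    (fun _ _ _ h => h.eq) (fun i => if i.down then x else x')
    (fun _ => g x) continuous_of_discreteTopology continuous_const
    (fun i => by by_cases h : i.down <;> simp [h, e])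
  exact (hd ⟨true⟩).symm.trans (hd ⟨false⟩)

theorem t1Fibres_rlp : t1Fibres.{u}.rlp = homeos :=
  le_antisymm t1Fibres_rlp_le_homeos (homeos_le_rlp _)

theorem t0Fibres_rlp : t0Fibres.{u}.rlp = homeos :=
  le_antisymm ((MorphismProperty.antitone_rlp t1Fibres_le_t0Fibres).trans t1Fibres_rlp_le_homeos)
    (homeos_le_rlp _)

end Quotients

/-! ### Embeddings, closed embeddings and dense maps -/

section Embeddings

theorem surjections_rlp : surjections.{u}.rlp = embeddings := by
  refine le_antisymm (fun X Y g hg => ?_) (fun X Y g hg => ?_)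
  · obtain ⟨d, hd, h, -⟩ := exists_lift_of_rlp hg
      (⟨rangeFactorization g, g.hom.continuous.rangeFactorization⟩ : C(X, range g))
      rangeFactorization_surjective id Subtype.val continuous_id continuous_subtype_val
      (fun _ => rfl)
    exact IsEmbedding.subtypeVal.comp
      (.of_leftInverse h hd g.hom.continuous.rangeFactorization)
  · refine rlp_intro fun A B f hf t b ht hb comm => ?_
    obtain ⟨d, hd, h⟩ := exists_continuous_factor_embedding hg hb fun y => by
      obtain ⟨a, rfl⟩ := hf y
      exact ⟨t a, comm a⟩
    exact ⟨d, hd, fun a => hg.injective (by rw [h, comm]), h⟩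

theorem embeddings_llp : embeddings.{u}.llp = surjections := by
  refine le_antisymm (fun A B f hf y => ?_) ?_
  · obtain ⟨d, -, -, h₂⟩ := exists_lift_of_llp hf
      (⟨Subtype.val, continuous_subtype_val⟩ : C(range f, B)) IsEmbedding.subtypeVal
      (fun a => ⟨f a, a, rfl⟩) id (f.hom.continuous.subtype_mk _) continuous_id (fun _ => rfl)
    obtain ⟨a, ha⟩ := (d y).2
    exact ⟨a, ha.trans (h₂ y)⟩
  · rw [MorphismProperty.le_llp_iff_le_rlp, surjections_rlp]

theorem dense_le_closedEmbeddings_llp : dense.{u} ≤ closedEmbeddings.llp := by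
  refine fun A B f hf => llp_intro fun X Y g hg t b ht hb comm => ?_
  obtain ⟨d, hd, h⟩ := exists_continuous_factor_embedding hg.isEmbedding hb fun y =>
    hf.induction_on (p := fun y => b y ∈ range g) y (hg.isClosed_range.preimage hb)
      fun a => ⟨t a, comm a⟩
  exact ⟨d, hd, fun a => hg.injective (by rw [h, comm]), h⟩

theorem closedEmbeddings_llp : closedEmbeddings.{u}.llp = dense := by
  refine le_antisymm (fun A B f hf y => ?_) dense_le_closedEmbeddings_llp
  obtain ⟨d, -, -, h₂⟩ := exists_lift_of_llp hf
    (⟨Subtype.val, continuous_subtype_val⟩ : C(closure (range f), B))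
    isClosed_closure.isClosedEmbedding_subtypeVal
    (fun a => ⟨f a, subset_closure ⟨a, rfl⟩⟩) id (f.hom.continuous.subtype_mk _) continuous_id
    (fun _ => rfl)
  have h : (d y : B) = y := h₂ y
  exact h ▸ (d y).2

theorem surjections_le_dense : surjections.{u} ≤ dense :=
  fun _ _ _ hf => Function.Surjective.denseRange hf

theorem dense_rlp : dense.{u}.rlp = closedEmbeddings := by
  refine le_antisymm (fun X Y g hg => ?_)
    ((MorphismProperty.le_llp_iff_le_rlp _ _).1 dense_le_closedEmbeddings_llp)
  have he := MorphismProperty.antitone_rlp surjections_le_dense g hg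
  rw [surjections_rlp] at he
  refine ⟨he, isClosed_of_closure_subset fun y hy => ?_⟩
  let f : C(X, closure (range g)) :=
    ⟨fun x => ⟨g x, subset_closure ⟨x, rfl⟩⟩, g.hom.continuous.subtype_mk _⟩
  have hf : DenseRange f := fun z => by
    rw [IsEmbedding.subtypeVal.closure_eq_preimage_closure_image, ← range_comp]
    exact z.2
  obtain ⟨d, -, -, h₂⟩ := exists_lift_of_rlp hg f hf id Subtype.val continuous_id
    continuous_subtype_val (fun _ => rfl)
  exact ⟨_, h₂ ⟨y, hy⟩⟩

theorem dense_le_clopenDense : dense.{u} ≤ clopenDense := by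
  intro A B f hf U hU h
  by_contra hne
  obtain ⟨a, ha⟩ := DenseRange.exists_mem_open hf hU.isOpen (nonempty_iff_ne_empty.2 hne)
  exact h a ha

/-- Such an `f` is already an open embedding, so its range is classified by a map to the Sierpiński
space. The inclusion of the open point is dense, and lifting against it makes the range everything.
-/
theorem dense_llp_le_homeos : dense.{u}.llp ≤ homeos := by
  intro A B f hf
  have h := MorphismProperty.antitone_llp surjections_le_dense f hf
  rw [surjections_llp] at h
  refine isIso_of_isEmbedding h.1.isEmbedding fun y => ?_
  let g : C(PUnit.{u + 1}, Sierp.{u}) := ⟨fun _ => ⟨True⟩, continuous_const⟩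
  have hg : DenseRange g := fun p => by
    refine mem_closure_iff.2 fun U hU hp => ⟨⟨True⟩, ?_, PUnit.unit, rfl⟩
    have h : (True : Prop) ⤳ p.down := by
      by_cases hp' : p.down <;> simp [Specializes, hp']
    exact (h.map continuous_uliftUp).mem_open hU hp
  obtain ⟨d, -, -, hd⟩ := exists_lift_of_llp hf g hg (fun _ => PUnit.unit) _ continuous_const
    (continuous_sierp h.1.isOpen_range) (fun a => by simp [g])
  have := congrArg ULift.down (hd y)
  simpa [g] using this

theorem dense_llp : dense.{u}.llp = homeos :=
  le_antisymm dense_llp_le_homeos (homeos_le_llp _)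

theorem clopenDense_llp : clopenDense.{u}.llp = homeos :=
  le_antisymm ((MorphismProperty.antitone_llp dense_le_clopenDense).trans dense_llp_le_homeos)
    (homeos_le_llp _)

end Embeddings


/-! ### Generic sections and closed embeddings -/

section GenericSections

/-- The lift is `t` on the closed subspace and `s ∘ b` off it. Genericity of the section is what
makes the two pieces fit continuously along the subspace. -/
theorem genericallySplit_le_closedEmbeddings_rlp :
    genericallySplit.{u} ≤ closedEmbeddings.rlp := by
  refine fun X Y g ⟨s, hs, hgs, hsg⟩ => rlp_intro fun A B f hf t b ht hb comm => ?_
  have hinj : Function.Injective f := hf.injective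
  have hout : ∀ y ∉ range f, Function.extend f t (s ∘ b) y = s (b y) := fun y hy =>
    Function.extend_apply' _ _ _ fun ⟨a, ha⟩ => hy ⟨a, ha⟩
  refine ⟨Function.extend f t (s ∘ b), ?_, hinj.extend_apply t _, fun y => ?_⟩
  · rw [continuous_def]
    intro V hV
    rw [isOpen_iff_mem_nhds]
    intro y hy
    by_cases hyf : y ∈ range f
    · obtain ⟨a, rfl⟩ := hyf
      rw [mem_preimage, hinj.extend_apply] at hy
      obtain ⟨O, hO, hOV⟩ := hf.isInducing.isOpen_iff.1 (hV.preimage ht)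
      have ha : f a ∈ O := by
        change a ∈ f ⁻¹' O
        rwa [hOV]
      -- The generic point of the fibre through `t a` lies in every open set containing `t a`, so `s
      -- ∘ b` also maps nearby points into `V`.
      have hsb : s (b (f a)) ∈ V := by
        rw [← comm]
        exact (hsg (t a)).mem_open hV hy
      filter_upwards [hO.mem_nhds ha, ((hV.preimage hs).preimage hb).mem_nhds hsb] with z hzO hz
      by_cases hzf : z ∈ range f
      · obtain ⟨a', rfl⟩ := hzf
        rw [mem_preimage, hinj.extend_apply]
        change a' ∈ t ⁻¹' V
        rw [← hOV]
        exact hzO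
      · rw [mem_preimage, hout z hzf]
        exact hz
    · rw [mem_preimage, hout y hyf] at hy
      filter_upwards [hf.isClosed_range.isOpen_compl.mem_nhds hyf,
        ((hV.preimage hs).preimage hb).mem_nhds hy] with z hzf hz
      rw [mem_preimage, hout z hzf]
      exact hz
  · by_cases hy : y ∈ range f
    · obtain ⟨a, rfl⟩ := hy
      rw [hinj.extend_apply, comm]
    · rw [hout y hy, hgs]

theorem clopenDense_rlp_le_closedEmbeddings : clopenDense.{u}.rlp ≤ closedEmbeddings := by
  rw [← dense_rlp]
  exact MorphismProperty.antitone_rlp dense_le_clopenDense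

section Extension

variable {X Y K : Type u} [TopologicalSpace X] [TopologicalSpace Y]

/-- The space `X` enlarged by isolated points indexed by `Y × K` which, along the neighbourhood
filters of `Y` and a filter on `K`, converge to the points of the fibres of `h : X → Y`. -/
def Isolated (_ : X → Y) (_ : Filter K) : Type u := X ⊕ (Y × K)

instance (h : X → Y) (F : Filter K) : TopologicalSpace (Isolated h F) where
  IsOpen W := IsOpen {x : X | Sum.inl x ∈ W} ∧
    ∀ x : X, Sum.inl x ∈ W → ∀ᶠ y in 𝓝 (h x), ∀ᶠ k in F, (Sum.inr (y, k) : X ⊕ (Y × K)) ∈ W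
  isOpen_univ := ⟨isOpen_univ, fun _ _ => .of_forall fun _ => .of_forall fun _ => trivial⟩
  isOpen_inter := fun _ _ h₁ h₂ => ⟨h₁.1.inter h₂.1, fun x hx => by
    filter_upwards [h₁.2 x hx.1, h₂.2 x hx.2] with y hy₁ hy₂
    filter_upwards [hy₁, hy₂] with k hk₁ hk₂
    exact ⟨hk₁, hk₂⟩⟩
  isOpen_sUnion := fun S hS => ⟨isOpen_setOf_mem_sUnion (Z := X ⊕ (Y × K)) Sum.inl
    fun W hW => (hS W hW).1, fun x ⟨W, hW, hx⟩ => by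
    filter_upwards [(hS W hW).2 x hx] with y hy
    filter_upwards [hy] with k hk
    exact ⟨W, hW, hk⟩⟩

theorem Isolated.isOpen_iff {h : X → Y} {F : Filter K} {W : Set (Isolated h F)} :
    IsOpen W ↔ IsOpen {x : X | (Sum.inl x : X ⊕ (Y × K)) ∈ W} ∧
      ∀ x : X, (Sum.inl x : X ⊕ (Y × K)) ∈ W →
        ∀ᶠ y in 𝓝 (h x), ∀ᶠ k in F, (Sum.inr (y, k) : X ⊕ (Y × K)) ∈ W :=
  Iff.rfl

/-- The inclusion of a space into its enlargement by isolated points. -/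
def Isolated.incl (h : X → Y) (F : Filter K) : C(X, Isolated h F) :=
  ⟨Sum.inl, ⟨fun _ hW => hW.1⟩⟩

/-- The projection of the enlargement by isolated points. -/
def Isolated.proj (h : C(X, Y)) (F : Filter K) : C(Isolated h F, Y) :=
  ⟨Sum.elim h Prod.fst, ⟨fun U hU => Isolated.isOpen_iff.2 ⟨hU.preimage h.continuous, fun x hx => by
    filter_upwards [hU.mem_nhds (show h x ∈ U from hx)] with y hy
    exact .of_forall fun _ => hy⟩⟩⟩

theorem Isolated.isEmbedding_incl (h : X → Y) (F : Filter K) :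
    IsEmbedding (Isolated.incl h F) := by
  refine ⟨isInducing_iff_nhds.2 fun x => ?_, Sum.inl_injective⟩
  refine le_antisymm ((Isolated.incl h F).continuous.tendsto x).le_comap fun V hV => ?_
  obtain ⟨O, hOV, hO, hx⟩ := mem_nhds_iff.1 hV
  refine mem_comap.2 ⟨(Sum.elim (· ∈ O) (fun _ => True) : X ⊕ (Y × K) → Prop),
    IsOpen.mem_nhds (Isolated.isOpen_iff.2 ⟨hO, fun _ _ => .of_forall fun _ => .of_forall fun _ =>
      trivial⟩) hx, fun z hz => hOV hz⟩

theorem Isolated.isClopen_singleton (h : X → Y) {F : Filter K} (hF : ∀ k, ∀ᶠ k' in F, k' ≠ k)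
    (y : Y) (k : K) : IsClopen ({(Sum.inr (y, k) : X ⊕ (Y × K))} : Set (Isolated h F)) := by
  refine ⟨⟨Isolated.isOpen_iff.2 ⟨?_, fun x _ => .of_forall fun y' => ?_⟩⟩,
    Isolated.isOpen_iff.2 ⟨?_, fun x hx => ?_⟩⟩
  · convert isOpen_univ
    exact eq_univ_of_forall fun x => Sum.inl_ne_inr
  · filter_upwards [hF k] with k' hk' e
    exact hk' (congrArg Prod.snd (Sum.inr_injective e))
  · convert isOpen_empty
    exact eq_empty_of_forall_notMem fun x => Sum.inl_ne_inr
  · exact absurd hx Sum.inl_ne_inr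

end Extension

/-- Each added point is clopen, so its preimage under `b` is a clopen set missing the image of `f`,
hence empty. Thus `b` lands in the embedded copy of `X`. -/
theorem clopenDense_rlp_isolated_incl {X Y K : Type u} [TopologicalSpace X] [TopologicalSpace Y]
    (h : X → Y) {F : Filter K} (hF : ∀ k, ∀ᶠ k' in F, k' ≠ k) :
    clopenDense.rlp (TopCat.ofHom (Isolated.incl h F)) := by
  refine rlp_intro fun A B f hf t b ht hb comm => ?_
  have hemb := Isolated.isEmbedding_incl h F
  obtain ⟨d, hd, hgd⟩ := exists_continuous_factor_embedding hemb hb fun z => by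
    obtain ⟨w, e⟩ : ∃ w : X ⊕ (Y × K), b z = w := ⟨_, rfl⟩
    rw [e]
    rcases w with x | ⟨y, k⟩
    · exact ⟨x, rfl⟩
    · have he := hf _ ((Isolated.isClopen_singleton h hF y k).preimage hb) fun a ha =>
        Sum.inl_ne_inr ((comm a).trans ha)
      exact absurd (show z ∈ (∅ : Set B) from he ▸ e) (notMem_empty z)
  exact ⟨d, hd, fun a => hemb.injective ((hgd _).trans (comm a).symm), hgd⟩

/-- Lifting against the inclusion into the isolated-point enlargement gives a retraction `d` onto
`X` over `Y`. The points `(y, k)` approach the whole fibre over `y`, so a value that `d` takes there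
frequently in `k` must be a generic point of that fibre. -/
theorem clopenDense_rlp_rlp_le_genericallySplit :
    clopenDense.{u}.rlp.rlp ≤ genericallySplit := by
  intro X Y h hh
  obtain ⟨K, F, hF, hc⟩ := exists_free_filter X
  obtain ⟨d, hd, h₁, h₂⟩ := exists_lift_of_rlp hh (Isolated.incl h F)
    (clopenDense_rlp_isolated_incl h hF) id (Isolated.proj h.hom F) continuous_id
    (Isolated.proj h.hom F).continuous (fun _ => rfl)
  -- The filter was chosen so that some value is taken frequently; this turns a whole family of
  -- lifts over `y` into one point.
  choose s hs using fun y : Y => hc fun k => d (Sum.inr (y, k) : X ⊕ (Y × K))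
  have hsec : ∀ y, h (s y) = y := fun y => by
    obtain ⟨k, hk⟩ := (hs y).exists
    rw [← hk]
    exact h₂ _
  -- A frequent event and an eventual one occur together, so `s y` inherits membership in `O` from
  -- `d (y, k)`. Applied at `x = s y` this gives continuity; evaluated at `h x` itself it gives
  -- genericity.
  have hlim : ∀ x : X, Tendsto s (𝓝 (h x)) (𝓝 x) := fun x V hV => by
    obtain ⟨O, hOV, hO, hx⟩ := mem_nhds_iff.1 hV
    have hx' : d (Sum.inl x : X ⊕ (Y × K)) ∈ O := (h₁ x).symm ▸ hx
    have hopen := (hO.preimage hd).2 x hx'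
    refine mem_map.2 ?_
    filter_upwards [hopen] with y hy
    obtain ⟨k, hk, hkO⟩ := ((hs y).and_eventually hy).exists
    rw [mem_preimage, ← hk]
    exact hOV hkO
  refine ⟨s, continuous_iff_continuousAt.2 fun y => ?_, hsec, fun x => ?_⟩
  · have := hlim (s y)
    rwa [hsec] at this
  · exact specializes_iff_forall_open.2 fun V hV hx =>
      (show h x ∈ s ⁻¹' V from mem_of_mem_nhds (mem_map.1 (hlim x (hV.mem_nhds hx))))

theorem clopenDense_rlp_rlp : clopenDense.{u}.rlp.rlp = genericallySplit :=
  le_antisymm clopenDense_rlp_rlp_le_genericallySplit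
    (genericallySplit_le_closedEmbeddings_rlp.trans
      (MorphismProperty.antitone_rlp clopenDense_rlp_le_closedEmbeddings))

theorem closedEmbeddings_rlp_le_genericallySplit :
    closedEmbeddings.{u}.rlp ≤ genericallySplit :=
  (MorphismProperty.antitone_rlp clopenDense_rlp_le_closedEmbeddings).trans
    clopenDense_rlp_rlp_le_genericallySplit

section Cylinder

variable {A B : Type u} [TopologicalSpace A] [TopologicalSpace B]

/-- The disjoint union of `A` and `B`, in which `f a` is a generization of `a`. -/
def OpenCylinder (_ : A → B) : Type u := A ⊕ B

instance (f : A → B) : TopologicalSpace (OpenCylinder f) where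
  IsOpen W := IsOpen {a : A | Sum.inl a ∈ W} ∧ IsOpen {y : B | Sum.inr y ∈ W} ∧
    ∀ a : A, Sum.inl a ∈ W → (Sum.inr (f a) : A ⊕ B) ∈ W
  isOpen_univ := ⟨isOpen_univ, isOpen_univ, fun _ _ => trivial⟩
  isOpen_inter := fun _ _ h₁ h₂ => ⟨h₁.1.inter h₂.1, h₁.2.1.inter h₂.2.1, fun a ha =>
    ⟨h₁.2.2 a ha.1, h₂.2.2 a ha.2⟩⟩
  isOpen_sUnion := fun _ hS =>
    ⟨isOpen_setOf_mem_sUnion (Z := A ⊕ B) Sum.inl fun W hW => (hS W hW).1,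
      isOpen_setOf_mem_sUnion (Z := A ⊕ B) Sum.inr fun W hW => (hS W hW).2.1,
      fun a ⟨W, hW, ha⟩ => ⟨W, hW, (hS W hW).2.2 a ha⟩⟩

theorem OpenCylinder.isOpen_iff {f : A → B} {W : Set (OpenCylinder f)} :
    IsOpen W ↔ IsOpen {a : A | (Sum.inl a : A ⊕ B) ∈ W} ∧
      IsOpen {y : B | (Sum.inr y : A ⊕ B) ∈ W} ∧
      ∀ a : A, (Sum.inl a : A ⊕ B) ∈ W → (Sum.inr (f a) : A ⊕ B) ∈ W :=
  Iff.rfl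

/-- The projection of the open mapping cylinder. -/
def OpenCylinder.proj (f : C(A, B)) : C(OpenCylinder f, B) :=
  ⟨Sum.elim f id, ⟨fun _ hU => OpenCylinder.isOpen_iff.2
    ⟨hU.preimage f.continuous, hU, fun _ ha => ha⟩⟩⟩

end Cylinder

/-- The cylinder projection is generically split by the copy of `B`, since `f a` is a generization
of `a`. That copy is open, so `A` is closed in the cylinder, and pulling back along the lift
exhibits `f` as a closed embedding. -/
theorem genericallySplit_llp : genericallySplit.{u}.llp = closedEmbeddings := by
  refine le_antisymm (fun A B f hf => ?_)
    ((MorphismProperty.le_llp_iff_le_rlp _ _).2 genericallySplit_le_closedEmbeddings_rlp)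
  obtain ⟨d, hd, h₁, h₂⟩ := exists_lift_of_llp hf (OpenCylinder.proj f.hom)
    ⟨Sum.inr, ⟨fun _ hW => hW.2.1⟩, fun _ => rfl, fun x => specializes_iff_forall_open.2
      fun W hW hx => by
        rcases x with a | y
        · exact hW.2.2 a hx
        · exact hx⟩
    Sum.inl id ⟨fun _ hW => hW.1⟩ continuous_id (fun _ => rfl)
  have hr : ∀ y a, d y = (Sum.inl a : A ⊕ B) → f a = y := fun y a e =>
    .trans (by rw [e]; rfl) (h₂ y)
  have hrange : range f = d ⁻¹' {z : A ⊕ B | ∃ y, z = Sum.inr y}ᶜ := by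
    ext y
    rcases e : (d y : A ⊕ B) with a | z
    · exact ⟨fun _ => fun ⟨z, hz⟩ => Sum.inl_ne_inr (e.symm.trans hz), fun _ => ⟨a, hr y a e⟩⟩
    · refine ⟨?_, fun h => absurd ⟨z, e⟩ h⟩
      rintro ⟨a, rfl⟩
      exact absurd ((h₁ a).symm.trans e) Sum.inl_ne_inr
  refine ⟨⟨isInducing_iff_nhds.2 fun a => le_antisymm (f.hom.continuous.tendsto a).le_comap
    fun V hV => ?_, fun a a' e => ?_⟩, ?_⟩
  · obtain ⟨O, hOV, hO, ha⟩ := mem_nhds_iff.1 hV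
    -- An open set of `A` becomes open in the cylinder once all of `B` is added.
    let W : Set (OpenCylinder f) := (Sum.elim (· ∈ O) (fun _ => True) : A ⊕ B → Prop)
    have hW : IsOpen W := OpenCylinder.isOpen_iff.2 ⟨hO, isOpen_univ, fun _ _ => trivial⟩
    refine mem_comap.2 ⟨d ⁻¹' W, (hW.preimage hd).mem_nhds ?_, fun a' ha' => hOV ?_⟩
    · rw [mem_preimage, h₁]
      exact ha
    · rw [mem_preimage, mem_preimage, h₁] at ha'
      exact ha'
  · exact Sum.inl_injective ((h₁ a).symm.trans ((congrArg d e).trans (h₁ a')))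
  · rw [hrange]
    refine IsClosed.preimage hd ⟨?_⟩
    rw [compl_compl]
    refine OpenCylinder.isOpen_iff.2 ⟨?_, ?_, fun a ⟨y, hy⟩ => absurd hy Sum.inl_ne_inr⟩
    · convert isOpen_empty
      exact eq_empty_of_forall_notMem fun _ ⟨_, hy⟩ => Sum.inl_ne_inr hy
    · convert isOpen_univ
      exact eq_univ_of_forall fun y => ⟨y, rfl⟩

end GenericSections


/-! ### T1 fibres and Sierpiński tests -/

section T1Fibres

/-- Maps to the Sierpiński space are open sets, and open sets of a subspace extend to the ambient
space. -/
theorem embeddings_rlp_toPoint_sierp :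
    embeddings.rlp (TopCat.ofHom (toPoint Sierp.{u})) := by
  refine rlp_intro fun A B f hf t b ht _ _ => ?_
  obtain ⟨V, hV, e⟩ := hf.isInducing.isOpen_iff.1 (isOpen_sierp ht)
  refine ⟨fun y => ⟨y ∈ V⟩, continuous_sierp hV, fun a => ULift.ext _ _ (propext ?_),
    fun _ => rfl⟩
  exact Set.ext_iff.1 e a

theorem embeddings_rlp_toPoint_indisc :
    embeddings.rlp (TopCat.ofHom (toPoint (Indisc (ULift.{u} Bool)))) :=
  rlp_intro fun _ _ _ hf t _ _ _ _ => ⟨Function.extend _ t fun _ => ⟨true⟩, continuous_top,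
    hf.injective.extend_apply t _, fun _ => rfl⟩

theorem closedEmbeddings_le_embeddings : closedEmbeddings.{u} ≤ embeddings :=
  fun _ _ _ hf => hf.isEmbedding

theorem embeddings_rlp_le_genericallySplit : embeddings.{u}.rlp ≤ genericallySplit :=
  (MorphismProperty.antitone_rlp closedEmbeddings_le_embeddings).trans
    closedEmbeddings_rlp_le_genericallySplit

/-- The Sierpiński space detects that `f` is inducing, the indiscrete two-point space that it is
injective. -/
theorem embeddings_rlp_llp : embeddings.{u}.rlp.llp = embeddings := by
  classical
  refine le_antisymm (fun A B f hf => ?_) (MorphismProperty.le_llp_rlp _)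
  refine ⟨isInducing_iff_nhds.2 fun a => le_antisymm (f.hom.continuous.tendsto a).le_comap
    fun V hV => ?_, fun a a' e => ?_⟩
  · obtain ⟨O, hOV, hO, ha⟩ := mem_nhds_iff.1 hV
    obtain ⟨d, hd, h, -⟩ := exists_lift_of_llp hf _ embeddings_rlp_toPoint_sierp
      (fun a => ⟨a ∈ O⟩) (fun _ => PUnit.unit) (continuous_sierp hO) continuous_const
      (fun _ => rfl)
    refine mem_comap.2 ⟨_, (isOpen_sierp hd).mem_nhds ?_, fun a' ha' => hOV ?_⟩
    · simpa [h] using ha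
    · simpa [h] using ha'
  · obtain ⟨d, -, h, -⟩ := exists_lift_of_llp hf _ embeddings_rlp_toPoint_indisc
      (fun x => ⟨decide (x = a)⟩) (fun _ => PUnit.unit) continuous_top continuous_const
      (fun _ => rfl)
    have := congrArg ULift.down ((h a).symm.trans ((congrArg d e).trans (h a')))
    simpa [eq_comm] using this

theorem rlp_le_t1Fibres {P : MorphismProperty TopCat.{u}}
    (hP : P (TopCat.ofHom (toPoint Sierp.{u}))) : P.rlp ≤ t1Fibres := by
  intro X Y g hg x y e h
  obtain ⟨d, -, hd, -⟩ := exists_lift_of_rlp hg _ hP _ (fun _ => g x)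
    (continuous_of_specializes h) continuous_const
    (fun p => by by_cases h : p.down <;> simp [h, e])
  have h₁ := hd ⟨True⟩
  have h₂ := hd ⟨False⟩
  simp only [if_true, if_false] at h₁ h₂
  exact h₁.symm.trans h₂

/-- The lift is `t ∘ s`. It agrees with `t` on `A` because `s (f a) ⤳ a` maps to a specialization
inside a T1 fibre. -/
theorem t1Fibres_le_genericallySplit_rlp : t1Fibres.{u} ≤ genericallySplit.rlp := by
  refine fun X Y g hg => rlp_intro fun A B f ⟨s, hs, hfs, hsf⟩ t b ht hb comm => ?_
  have hd : ∀ y, g (t (s y)) = b y := fun y => by rw [comm, hfs]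
  exact ⟨t ∘ s, ht.comp hs, fun a => hg _ _ ((hd _).trans (comm a).symm) ((hsf a).map ht), hd⟩

theorem genericallySplit_rlp : genericallySplit.{u}.rlp = t1Fibres :=
  le_antisymm (rlp_le_t1Fibres
    (embeddings_rlp_le_genericallySplit _ embeddings_rlp_toPoint_sierp))
    t1Fibres_le_genericallySplit_rlp

theorem embeddings_rlp_rlp : embeddings.{u}.rlp.rlp = t1Fibres :=
  le_antisymm (rlp_le_t1Fibres embeddings_rlp_toPoint_sierp)
    (t1Fibres_le_genericallySplit_rlp.trans
      (MorphismProperty.antitone_rlp embeddings_rlp_le_genericallySplit))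

theorem t1Fibres_llp_le_quotients : t1Fibres.{u}.llp ≤ quotients := by
  rw [← injections_llp]
  exact MorphismProperty.antitone_llp injections_le_t1Fibres

end T1Fibres

/-! ### A resolution with T1-contractible fibres -/

section Resolution

variable {A B : Type u} [TopologicalSpace A] [TopologicalSpace B]

/-- A space over `B` that consists of `A`, of infinitely many sequences of points for each point `b`
of `B`, which converge to points over `b` along neighbourhoods of `b`, and of a point for each
fibre that is in the closure of all the points of the fibre. -/
inductive Resolution (f : A → B) : Type u
  | base (a : A) : Resolution f
  | seq (b c : B) (n : ℕ) : Resolution f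
  | cone (b : B) : Resolution f

namespace Resolution

/-- The projection of the resolution, as a function. -/
def toBase (f : A → B) : Resolution f → B
  | base a => f a
  | seq _ c _ => c
  | cone b => b

instance (f : A → B) : TopologicalSpace (Resolution f) where
  IsOpen W := IsOpen {a | base a ∈ W} ∧
    (∀ b n, seq b b n ∈ W → ∀ᶠ c in 𝓝 b, ∀ᶠ k in cofinite, seq b c k ∈ W) ∧
    ∀ b, cone b ∈ W → ∀ z, toBase f z = b → z ∈ W
  isOpen_univ := ⟨isOpen_univ, fun _ _ _ => .of_forall fun _ => .of_forall fun _ => trivial,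
    fun _ _ _ _ => trivial⟩
  isOpen_inter := fun _ _ h₁ h₂ => by
    refine ⟨h₁.1.inter h₂.1, fun b n hb => ?_,
      fun b hb z hz => ⟨h₁.2.2 b hb.1 z hz, h₂.2.2 b hb.2 z hz⟩⟩
    filter_upwards [h₁.2.1 b n hb.1, h₂.2.1 b n hb.2] with c hc₁ hc₂
    filter_upwards [hc₁, hc₂] with k hk₁ hk₂
    exact ⟨hk₁, hk₂⟩
  isOpen_sUnion := fun S hS => by
    refine ⟨isOpen_setOf_mem_sUnion base fun W hW => (hS W hW).1, fun b n ⟨W, hW, hb⟩ => ?_,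
      fun b ⟨W, hW, hb⟩ z hz => ⟨W, hW, (hS W hW).2.2 b hb z hz⟩⟩
    filter_upwards [(hS W hW).2.1 b n hb] with c hc
    filter_upwards [hc] with k hk
    exact ⟨W, hW, hk⟩

theorem isOpen_iff {f : A → B} {W : Set (Resolution f)} :
    IsOpen W ↔ IsOpen {a | base a ∈ W} ∧
      (∀ b n, seq b b n ∈ W → ∀ᶠ c in 𝓝 b, ∀ᶠ k in cofinite, seq b c k ∈ W) ∧
      ∀ b, cone b ∈ W → ∀ z, toBase f z = b → z ∈ W :=
  Iff.rfl

theorem continuous_toBase {f : A → B} (hf : Continuous f) : Continuous (toBase f) :=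
  ⟨fun U hU => isOpen_iff.2 ⟨hU.preimage hf, fun b _ hb => by
    filter_upwards [hU.mem_nhds (show b ∈ U from hb)] with c hc
    exact .of_forall fun _ => hc, fun b hb z hz => by
    rw [mem_preimage, hz]
    exact hb⟩⟩

/-- The sequences recover the topology of `B`: an open preimage containing `seq b b 0` contains
points over every `c` near `b`. -/
theorem isQuotientMap_toBase {f : A → B} (hf : Continuous f) : IsQuotientMap (toBase f) := by
  refine (isQuotientMap_iff _).2 ⟨isCoinducing_iff.2 fun U => ⟨fun h => ?_,
    fun h => h.preimage (continuous_toBase hf)⟩, fun b => ⟨cone b, rfl⟩⟩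
  refine isOpen_iff_mem_nhds.2 fun b hb => ?_
  filter_upwards [h.2.1 b 0 hb] with c hc
  obtain ⟨k, hk⟩ := hc.exists
  exact hk

theorem specializes_cone {f : A → B} (z : Resolution f) : z ⤳ cone (toBase f z) :=
  specializes_iff_forall_open.2 fun _ hW h => hW.2.2 _ h z rfl

theorem isOpenEmbedding_base (f : A → B) : IsOpenEmbedding (base : A → Resolution f) := by
  refine .of_continuous_injective_isOpenMap ⟨fun _ hW => hW.1⟩
    (fun a a' e => by injection e) fun O hO => isOpen_iff.2 ⟨?_, ?_, ?_⟩
  · convert hO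
    ext a
    simp
  · rintro b n ⟨a, -, ha⟩
    cases ha
  · rintro b ⟨a, -, ha⟩
    cases ha

/-- A section meets each fibre once, so it can be avoided by the sequences issuing from `c`, which
are cofinite in each fibre after deleting at most one term. -/
theorem isOpen_singleton_of_section {f : A → B} {s : B → Resolution f} (hs : Continuous s)
    (hsec : ∀ y, toBase f (s y) = y) {c : B} (hc : c ∉ range f) : IsOpen {c} := by
  -- The fibre over `c`, thickened by the sequences at `c` with the values of `s` removed. It is
  -- open, contains no `base` point since `c ∉ range f`, and meets the image of `s` only in `s c`.
  let W : Set (Resolution f) := {z | toBase f z = c ∨ ∃ b k, z = seq c b k ∧ z ≠ s b}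
  have hW : IsOpen W := by
    refine isOpen_iff.2 ⟨?_, fun b n hb => ?_, fun b hb z hz => ?_⟩
    · convert isOpen_empty
      refine eq_empty_of_forall_notMem fun a ha => ?_
      rcases ha with ha | ⟨b, k, ha, -⟩
      · exact hc ⟨a, ha⟩
      · cases ha
    · have hbc : b = c := by
        rcases hb with hb | ⟨b', k, hb, -⟩
        · exact hb
        · injection hb
      subst hbc
      refine .of_forall fun c' => ?_
      have hfin : {k | seq b c' k = s c'}.Finite :=
        Set.Subsingleton.finite fun k hk k' hk' => by
          have := hk.trans hk'.symm
          injection this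
      filter_upwards [hfin.compl_mem_cofinite] with k hk
      exact Or.inr ⟨c', k, rfl, hk⟩
    · rcases hb with hb | ⟨b', k, hb, -⟩
      · exact Or.inl (hz.trans hb)
      · cases hb
  convert hW.preimage hs
  ext y
  constructor
  · rintro rfl
    exact Or.inl (hsec _)
  · rintro (hy | ⟨b, k, hy, hne⟩)
    · exact (hsec y).symm.trans hy
    · have : y = b := by rw [← hsec y, hy]; rfl
      exact absurd (congrArg s this) hne

end Resolution

/-- All points of a fibre specialize to its cone point, so a map into T1 fibres collapses them and
descends along the quotient map. -/
theorem t1Fibres_llp_toBase {f : A → B} (hf : Continuous f) :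
    t1Fibres.llp (TopCat.ofHom ⟨Resolution.toBase f, Resolution.continuous_toBase hf⟩) := by
  refine llp_intro fun X Y g hg t b ht hb comm => ?_
  have hcone : ∀ z, t z = t (.cone (Resolution.toBase f z)) := fun z =>
    hg _ _ ((comm z).trans (comm (.cone (Resolution.toBase f z))).symm)
      ((Resolution.specializes_cone z).map ht)
  obtain ⟨d, hd, h⟩ := exists_continuous_factor (Resolution.isQuotientMap_toBase hf) ht
    fun z z' e => by rw [hcone z, hcone z', e]
  exact ⟨d, hd, h, fun y => (congrArg g (h (.cone y))).trans (comm (.cone y))⟩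

/-- A lift of the identity of `B` extending `base` is a section of the resolution. The open
embedding `base` makes `f` an open embedding, and the section isolates every point off the range. -/
theorem t1Fibres_llp_llp_le_discreteExtensions :
    t1Fibres.{u}.llp.llp ≤ discreteExtensions := by
  intro A B f hf
  obtain ⟨s, hs, h₁, h₂⟩ := exists_lift_of_llp hf _ (t1Fibres_llp_toBase f.hom.continuous)
    Resolution.base id (Resolution.isOpenEmbedding_base _).continuous continuous_id
    (fun _ => rfl)
  have hbase := Resolution.isOpenEmbedding_base f
  have hcomp : s ∘ f = Resolution.base := funext h₁
  refine ⟨⟨.of_comp f.hom.continuous hs (hcomp ▸ hbase.isEmbedding), ?_⟩,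
    fun y hy => Resolution.isOpen_singleton_of_section hs h₂ hy⟩
  convert hbase.isOpen_range.preimage hs
  ext y
  constructor
  · rintro ⟨a, rfl⟩
    exact ⟨a, (h₁ a).symm⟩
  · rintro ⟨a, ha⟩
    exact ⟨a, (congrArg (Resolution.toBase f) ha).trans (h₂ y)⟩

end Resolution

theorem discreteExtensions_le_quotients_llp : discreteExtensions.{u} ≤ quotients.llp := by
  rw [← surjections_llp]
  exact MorphismProperty.antitone_llp fun _ _ _ hf => IsQuotientMap.surjective hf

theorem t1Fibres_llp_llp : t1Fibres.{u}.llp.llp = discreteExtensions :=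
  le_antisymm t1Fibres_llp_llp_le_discreteExtensions
    (discreteExtensions_le_quotients_llp.trans
      (MorphismProperty.antitone_llp t1Fibres_llp_le_quotients))

theorem quotients_llp : quotients.{u}.llp = discreteExtensions :=
  le_antisymm ((MorphismProperty.antitone_llp t1Fibres_llp_le_quotients).trans
    t1Fibres_llp_llp_le_discreteExtensions) discreteExtensions_le_quotients_llp


/-! ### Assembling the Schreier graph -/

section Orbit

theorem emptySourceOrIso_llp : emptySourceOrIso.{u}.llp = nonemptySource := by
  rw [← nonemptySource_rlp, ← emptyToPointClass_llp, MorphismProperty.llp_rlp_llp]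

theorem clopenEmbeddings_rlp : clopenEmbeddings.{u}.rlp = split := by
  rw [← split_llp, ← emptySourceOrIso_rlp, MorphismProperty.rlp_llp_rlp]

theorem quotients_rlp : quotients.{u}.rlp = injections := by
  rw [← injections_llp, ← split_rlp, MorphismProperty.rlp_llp_rlp]

theorem discreteExtensions_rlp : discreteExtensions.{u}.rlp = surjections := by
  rw [← surjections_llp, ← emptyToPointClass_rlp, MorphismProperty.rlp_llp_rlp]

theorem clopenDense_rlp_llp : clopenDense.{u}.rlp.llp = clopenDense := by
  rw [← discreteExtensions_llp, MorphismProperty.llp_rlp_llp]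

theorem closedEmbeddings_rlp : closedEmbeddings.{u}.rlp = genericallySplit := by
  rw [← genericallySplit_llp, ← clopenDense_rlp_rlp, MorphismProperty.rlp_llp_rlp]

theorem t1Fibres_llp_rlp : t1Fibres.{u}.llp.rlp = t1Fibres := by
  rw [← genericallySplit_rlp, MorphismProperty.rlp_llp_rlp]

/-- A description of the class of maps attached to a vertex of the Schreier graph. -/
def Vertex.describe : Vertex → MorphismProperty TopCat.{u}
  | .l => nonemptySource
  | .ll => homeos
  | .lll => ⊤
  | .lr => emptySourceOrIso
  | .lrr => split
  | .lrrl => clopenEmbeddings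
  | .lrrr => injections
  | .lrrrl => quotients
  | .lrrrr => inducingSurjections
  | .lrrrrr => t0Fibres
  | .r => surjections
  | .rl => discreteExtensions
  | .rll => clopenDense
  | .rllr => clopenDense.rlp
  | .rllrr => genericallySplit
  | .rllrrl => closedEmbeddings
  | .rllrrll => dense
  | .rr => embeddings
  | .rrr => embeddings.rlp
  | .rrrr => t1Fibres
  | .rrrrl => t1Fibres.llp

theorem Vertex.toClass_eq (x : Vertex) : x.toClass = x.describe.{u} := by
  cases x <;>
    simp only [Vertex.toClass, Vertex.word, act, List.foldl_cons, List.foldl_nil, orth,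
      Vertex.describe, emptyToPointClass_llp, emptyToPointClass_rlp, nonemptySource_llp,
      nonemptySource_rlp, homeos_llp, emptySourceOrIso_rlp, split_llp, split_rlp, injections_llp,
      injections_rlp, inducingSurjections_rlp, surjections_llp, surjections_rlp,
      discreteExtensions_llp, clopenDense_rlp_rlp, genericallySplit_llp, closedEmbeddings_llp,
      embeddings_rlp_rlp]

theorem Vertex.orth_l_toClass (x : Vertex) : orth .l x.toClass = x.left.toClass.{u} := by
  rw [x.toClass_eq, x.left.toClass_eq]
  cases x <;>
    simp only [orth, Vertex.left, Vertex.describe, nonemptySource_llp, homeos_llp, top_llp,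
      emptySourceOrIso_llp, split_llp, clopenEmbeddings_llp, injections_llp, quotients_llp,
      inducingSurjections_llp, t0Fibres_llp, surjections_llp, discreteExtensions_llp,
      clopenDense_llp, clopenDense_rlp_llp, genericallySplit_llp, closedEmbeddings_llp, dense_llp,
      embeddings_llp, embeddings_rlp_llp, t1Fibres_llp_llp]

theorem Vertex.orth_r_toClass (x : Vertex) : orth .r x.toClass = x.right.toClass.{u} := by
  rw [x.toClass_eq, x.right.toClass_eq]
  cases x <;>
    simp only [orth, Vertex.right, Vertex.describe, nonemptySource_rlp, homeos_rlp, top_rlp,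
      emptySourceOrIso_rlp, split_rlp, clopenEmbeddings_rlp, injections_rlp, quotients_rlp,
      inducingSurjections_rlp, t0Fibres_rlp, surjections_rlp, discreteExtensions_rlp,
      clopenDense_rlp_rlp, genericallySplit_rlp, closedEmbeddings_rlp, dense_rlp,
      embeddings_rlp_rlp, t1Fibres_rlp, t1Fibres_llp_rlp]

/-- The end point of the edge with a given label. -/
def Vertex.next (x : Vertex) : Letter → Vertex
  | .l => x.left
  | .r => x.right

theorem Vertex.orth_toClass (x : Vertex) (a : Letter) :
    orth a x.toClass = (x.next a).toClass.{u} := by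
  cases a
  · exact x.orth_l_toClass
  · exact x.orth_r_toClass

theorem Vertex.toClass_foldl_next {x y : Vertex} (h : x.toClass.{u} = y.toClass)
    (w : List Letter) : (w.foldl next x).toClass.{u} = (w.foldl next y).toClass := by
  induction w generalizing x y with
  | nil => exact h
  | cons a w ih =>
    refine ih ?_
    rw [← orth_toClass, ← orth_toClass, h]

theorem act_concat {C : Type u} [Category.{v} C] (P : MorphismProperty C) (w : List Letter)
    (a : Letter) : act P (w ++ [a]) = orth a (act P w) := by
  simp [act]

theorem range_toClass :
    range Vertex.toClass.{u} = iteratedOrthogonals emptyToPointClass.{u} := by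
  refine subset_antisymm ?_ ?_
  · rintro _ ⟨x, rfl⟩
    exact ⟨x.word, by cases x <;> simp [Vertex.word], rfl⟩
  · rintro _ ⟨w, hw, rfl⟩
    induction w using List.reverseRecOn with
    | nil => exact absurd rfl hw
    | append_singleton w a ih =>
      rw [act_concat]
      by_cases h : w = []
      · subst h
        cases a
        · exact ⟨.l, rfl⟩
        · exact ⟨.r, rfl⟩
      · obtain ⟨x, hx⟩ := ih h
        exact ⟨x.next a, by rw [← hx, x.orth_toClass]⟩

/-- Every orthogonal contains all isomorphisms, whereas the identity of the point is not in the
generating class. -/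
theorem emptyToPointClass_notMem :
    emptyToPointClass.{u} ∉ iteratedOrthogonals emptyToPointClass.{u} := by
  rintro ⟨w, hw, h⟩
  obtain ⟨w, a, rfl⟩ := List.eq_nil_or_concat' w |>.resolve_left hw
  rw [act_concat] at h
  have hid : homeos (𝟙 (TopCat.of PUnit.{u + 1})) :=
    (inferInstance : IsIso (𝟙 (TopCat.of PUnit.{u + 1})))
  have hmem : emptyToPointClass (𝟙 (TopCat.of PUnit.{u + 1})) := by
    rw [h]
    cases a
    · exact homeos_le_llp _ _ hid
    · exact homeos_le_rlp _ _ hid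
  obtain ⟨-, e⟩ := (MorphismProperty.ofHoms_iff _ _).1 hmem
  have hl : TopCat.of PUnit.{u + 1} = TopCat.of PEmpty.{u + 1} := congrArg Comma.left e
  have ht : PUnit.{u + 1} = PEmpty.{u + 1} := congrArg (fun X : TopCat.{u} => (X : Type u)) hl
  exact (cast ht PUnit.unit).elim

end Orbit


/-! ### Distinctness of the 21 classes -/

section Separation

theorem specializes_false (p : Sierp.{u}) : p ⤳ ⟨False⟩ := by
  have h : p.down ⤳ False := by simp [Specializes]
  exact h.map continuous_uliftUp

theorem eq_of_inseparable_sierp {p q : Sierp.{u}} (h : Inseparable p q) : p = q :=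
  ULift.ext _ _ (h.map continuous_uliftDown).eq

/-- The inclusion of the closed point of the Sierpiński space. -/
def closedPoint : C(PUnit.{u + 1}, Sierp.{u}) := ⟨fun _ => ⟨False⟩, continuous_const⟩

theorem not_injective_toPoint_sierp : ¬ Function.Injective (toPoint Sierp.{u}) := fun h => by
  have : (⟨True⟩ : Sierp.{u}) = ⟨False⟩ := h rfl
  simpa using congrArg ULift.down this

theorem not_surjective_closedPoint : ¬ Function.Surjective closedPoint.{u} := fun h => by
  obtain ⟨x, hx⟩ := h ⟨True⟩
  simpa [closedPoint] using congrArg ULift.down hx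

theorem injective_closedPoint : Function.Injective closedPoint.{u} := fun _ _ _ => rfl

theorem isClosedEmbedding_closedPoint : IsClosedEmbedding closedPoint.{u} := by
  refine ⟨.of_leftInverse (f := toPoint Sierp.{u}) (fun _ => rfl) (toPoint _).continuous
    closedPoint.continuous, ⟨?_⟩⟩
  convert isOpen_sierp (continuous_id (X := Sierp.{u}))
  ext p
  constructor
  · intro h
    by_contra hp
    exact h ⟨PUnit.unit, ULift.ext _ _ (by simpa [closedPoint] using hp)⟩
  · rintro hp ⟨x, rfl⟩
    exact hp

theorem not_isOpen_range_closedPoint : ¬ IsOpen (range closedPoint.{u}) := fun h =>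
  not_surjective_closedPoint fun p =>
    (specializes_false p).mem_open h ⟨PUnit.unit, rfl⟩

theorem clopenDense_closedPoint : clopenDense (TopCat.ofHom closedPoint.{u}) := fun _ hU h =>
  eq_empty_of_forall_notMem fun p hp =>
    (specializes_false p).mem_open hU.compl.isOpen (h PUnit.unit) hp

theorem surjective_of_homeos {A B : TopCat.{u}} {f : A ⟶ B} (h : homeos f) :
    Function.Surjective f :=
  ((TopCat.isIso_iff_isHomeomorph f).1 h).surjective

theorem injective_of_homeos {A B : TopCat.{u}} {f : A ⟶ B} (h : homeos f) :
    Function.Injective f :=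
  ((TopCat.isIso_iff_isHomeomorph f).1 h).injective

theorem surjective_of_genericallySplit {A B : TopCat.{u}} {f : A ⟶ B} (h : genericallySplit f) :
    Function.Surjective f :=
  fun y => ⟨_, h.choose_spec.2.1 y⟩

/-- Whether the class attached to a vertex contains the map from the Sierpiński space to the
point. -/
def Vertex.hasSierp : Vertex → Bool
  | .l | .lll | .lrr | .lrrrl | .lrrrrr | .r | .rll | .rllrr | .rllrrll | .rrr | .rrrrl => true
  | _ => false

/-- Whether the class attached to a vertex contains the inclusion of the closed point of the
Sierpiński space. -/
def Vertex.hasClosedPoint : Vertex → Bool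
  | .l | .lll | .lrrr | .lrrrrr | .rll | .rllrrl | .rr | .rrrr => true
  | _ => false

theorem Vertex.describe_toPoint_sierp (x : Vertex) :
    x.describe (TopCat.ofHom (toPoint Sierp.{u})) ↔ x.hasSierp = true := by
  have hs : Function.Surjective (toPoint Sierp.{u}) := fun _ => ⟨⟨True⟩, rfl⟩
  have hg := embeddings_rlp_le_genericallySplit _ embeddings_rlp_toPoint_sierp.{u}
  have hq : t1Fibres.llp (TopCat.ofHom (toPoint Sierp.{u})) := by
    rw [← embeddings_rlp_rlp]
    exact MorphismProperty.le_llp_rlp _ _ embeddings_rlp_toPoint_sierp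
  have hi := not_injective_toPoint_sierp.{u}
  cases x
  case l => exact iff_of_true (fun _ => ⟨⟨True⟩⟩) rfl
  case ll => exact iff_of_false (fun h => hi (injective_of_homeos h)) Bool.false_ne_true
  case lll => exact iff_of_true trivial rfl
  case lr =>
    exact iff_of_false (fun h => h.elim (fun h => h.elim ⟨True⟩)
      fun h => hi (injective_of_homeos h)) Bool.false_ne_true
  case lrr => exact iff_of_true ⟨hg.choose, hg.choose_spec.1, hg.choose_spec.2.1⟩ rfl
  case lrrl => exact iff_of_false (fun h => hi h.1.injective) Bool.false_ne_true
  case lrrr => exact iff_of_false hi Bool.false_ne_true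
  case lrrrl => exact iff_of_true (t1Fibres_llp_le_quotients _ hq) rfl
  case lrrrr =>
    exact iff_of_false (fun h => hi fun p q _ => eq_of_inseparable_sierp
      (h.2.inseparable_iff.1 rfl)) Bool.false_ne_true
  case lrrrrr => exact iff_of_true (fun _ _ _ h => eq_of_inseparable_sierp h) rfl
  case r => exact iff_of_true hs rfl
  case rl => exact iff_of_false (fun h => hi h.1.injective) Bool.false_ne_true
  case rll => exact iff_of_true (dense_le_clopenDense _ hs.denseRange) rfl
  case rllr =>
    exact iff_of_false (fun h : clopenDense.rlp (TopCat.ofHom (toPoint Sierp.{u})) =>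
      hi (IsEmbedding.injective (closedEmbeddings_le_embeddings _
        (clopenDense_rlp_le_closedEmbeddings _ h)))) Bool.false_ne_true
  case rllrr => exact iff_of_true hg rfl
  case rllrrl => exact iff_of_false (fun h => hi h.injective) Bool.false_ne_true
  case rllrrll => exact iff_of_true hs.denseRange rfl
  case rr => exact iff_of_false (fun h => hi h.injective) Bool.false_ne_true
  case rrr => exact iff_of_true embeddings_rlp_toPoint_sierp rfl
  case rrrr =>
    exact iff_of_false (fun h : t1Fibres (TopCat.ofHom (toPoint Sierp.{u})) => hi fun p q _ =>
      (h p ⟨False⟩ rfl (specializes_false p)).trans (h q ⟨False⟩ rfl (specializes_false q)).symm)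
      Bool.false_ne_true
  case rrrrl => exact iff_of_true hq rfl

theorem Vertex.describe_closedPoint (x : Vertex) :
    x.describe (TopCat.ofHom closedPoint.{u}) ↔ x.hasClosedPoint = true := by
  have hs := not_surjective_closedPoint.{u}
  have ht : t1Fibres (TopCat.ofHom closedPoint.{u}) :=
    injections_le_t1Fibres _ injective_closedPoint
  have hc := isClosedEmbedding_closedPoint.{u}
  cases x
  case l => exact iff_of_true (fun _ => ⟨PUnit.unit⟩) rfl
  case ll => exact iff_of_false (fun h => hs (surjective_of_homeos h)) Bool.false_ne_true
  case lll => exact iff_of_true trivial rfl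
  case lr =>
    exact iff_of_false (fun h => h.elim (fun h => h.elim PUnit.unit)
      fun h => hs (surjective_of_homeos h)) Bool.false_ne_true
  case lrr => exact iff_of_false (fun h => hs fun y => ⟨_, h.choose_spec.2 y⟩) Bool.false_ne_true
  case lrrl =>
    exact iff_of_false (fun h : clopenEmbeddings (TopCat.ofHom closedPoint.{u}) =>
      not_isOpen_range_closedPoint h.1.isOpen_range) Bool.false_ne_true
  case lrrr => exact iff_of_true injective_closedPoint rfl
  case lrrrl => exact iff_of_false (fun h => hs (IsQuotientMap.surjective h)) Bool.false_ne_true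
  case lrrrr => exact iff_of_false (fun h => hs h.1) Bool.false_ne_true
  case lrrrrr => exact iff_of_true (t1Fibres_le_t0Fibres _ ht) rfl
  case r => exact iff_of_false hs Bool.false_ne_true
  case rl =>
    exact iff_of_false (fun h : discreteExtensions (TopCat.ofHom closedPoint.{u}) =>
      not_isOpen_range_closedPoint h.1.isOpen_range) Bool.false_ne_true
  case rll => exact iff_of_true clopenDense_closedPoint rfl
  case rllr =>
    exact iff_of_false (fun h => hs (surjective_of_homeos
      (isIso_of_self_lift _ (h _ clopenDense_closedPoint)))) Bool.false_ne_true
  case rllrr =>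
    exact iff_of_false (fun h => hs (surjective_of_genericallySplit (f := TopCat.ofHom closedPoint) h))
      Bool.false_ne_true
  case rllrrl => exact iff_of_true hc rfl
  case rllrrll =>
    exact iff_of_false (fun h => hs (range_eq_univ.1
      (hc.isClosed_range.closure_eq.symm.trans (DenseRange.closure_range h)))) Bool.false_ne_true
  case rr => exact iff_of_true hc.isEmbedding rfl
  case rrr =>
    exact iff_of_false (fun h => hs (surjective_of_genericallySplit
      (f := TopCat.ofHom closedPoint)
      (embeddings_rlp_le_genericallySplit _ h))) Bool.false_ne_true
  case rrrr => exact iff_of_true ht rfl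
  case rrrrl =>
    exact iff_of_false (fun h => hs (IsQuotientMap.surjective
      (t1Fibres_llp_le_quotients _ h))) Bool.false_ne_true

/-- An enumeration of the vertices of the Schreier graph. -/
def Vertex.equivFin : Vertex ≃ Fin 21 where
  toFun
    | .l => 0 | .ll => 1 | .lll => 2 | .lr => 3 | .lrr => 4 | .lrrl => 5 | .lrrr => 6
    | .lrrrl => 7 | .lrrrr => 8 | .lrrrrr => 9 | .r => 10 | .rl => 11 | .rll => 12 | .rllr => 13
    | .rllrr => 14 | .rllrrl => 15 | .rllrrll => 16 | .rr => 17 | .rrr => 18 | .rrrr => 19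
    | .rrrrl => 20
  invFun := ![.l, .ll, .lll, .lr, .lrr, .lrrl, .lrrr, .lrrrl, .lrrrr, .lrrrrr, .r, .rl, .rll,
    .rllr, .rllrr, .rllrrl, .rllrrll, .rr, .rrr, .rrrr, .rrrrl]
  left_inv x := by cases x <;> rfl
  right_inv i := by fin_cases i <;> rfl

/-- Words that separate the vertices through `Vertex.hasSierp`. -/
def sierpWords : List (List Letter) :=
  [[], [.l, .l], [.r, .r], [.r, .r, .l, .l], [.r, .r, .r], [.l, .r, .r, .r]]

/-- Words that separate the vertices through `Vertex.hasClosedPoint`. -/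
def closedPointWords : List (List Letter) :=
  [[], [.r, .r], [.l, .l, .r], [.l, .r, .r, .l], [.r, .l], [.r, .r, .l], [.l, .l, .l, .r]]

/-- This is state separation in a finite automaton: follow each word in the graph and compare the
two Boolean labels at its end. Transport to `Fin 21` makes the check decidable. -/
theorem Vertex.eq_of_tests {x y : Vertex}
    (h₁ : ∀ w ∈ sierpWords, (w.foldl next x).hasSierp = (w.foldl next y).hasSierp)
    (h₂ : ∀ w ∈ closedPointWords,
      (w.foldl next x).hasClosedPoint = (w.foldl next y).hasClosedPoint) : x = y := by
  have key : ∀ i j : Fin 21,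
      (∀ w ∈ sierpWords, (w.foldl next (equivFin.symm i)).hasSierp =
        (w.foldl next (equivFin.symm j)).hasSierp) →
      (∀ w ∈ closedPointWords, (w.foldl next (equivFin.symm i)).hasClosedPoint =
        (w.foldl next (equivFin.symm j)).hasClosedPoint) → i = j := by
    decide
  exact equivFin.injective (key _ _ (by simpa using h₁) (by simpa using h₂))

/-- Equal classes stay equal along every word, so their memberships of the two test maps agree there
as well. -/
theorem Vertex.toClass_injective : Function.Injective Vertex.toClass.{u} := by
  intro x y h
  refine eq_of_tests (fun w _ => Bool.eq_iff_iff.2 ?_) (fun w _ => Bool.eq_iff_iff.2 ?_)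
  · rw [← describe_toPoint_sierp.{u}, ← describe_toPoint_sierp.{u}, ← toClass_eq, ← toClass_eq,
      toClass_foldl_next h]
  · rw [← describe_closedPoint.{u}, ← describe_closedPoint.{u}, ← toClass_eq, ← toClass_eq,
      toClass_foldl_next h]

end Separation

end QuillenNegation

theorem mainTheorem1 :
    (QuillenNegation.iteratedOrthogonals QuillenNegation.emptyToPointClass.{u}).Finite ∧
    (QuillenNegation.iteratedOrthogonals QuillenNegation.emptyToPointClass.{u}).ncard = 21 ∧
    QuillenNegation.emptyToPointClass.{u} ∉
      QuillenNegation.iteratedOrthogonals QuillenNegation.emptyToPointClass.{u} ∧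
    Function.Injective QuillenNegation.Vertex.toClass.{u} ∧
    Set.range QuillenNegation.Vertex.toClass.{u} =
      QuillenNegation.iteratedOrthogonals QuillenNegation.emptyToPointClass.{u} ∧
    (∀ x : QuillenNegation.Vertex,
      QuillenNegation.orth QuillenNegation.Letter.l x.toClass =
          (QuillenNegation.Vertex.toClass.{u} x.left) ∧
      QuillenNegation.orth QuillenNegation.Letter.r x.toClass =
          (QuillenNegation.Vertex.toClass.{u} x.right)) := by
  have : Finite QuillenNegation.Vertex := .of_equiv _ QuillenNegation.Vertex.equivFin.symm
  refine ⟨?_, ?_, QuillenNegation.emptyToPointClass_notMem,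
    QuillenNegation.Vertex.toClass_injective, QuillenNegation.range_toClass,
    fun x => ⟨x.orth_l_toClass, x.orth_r_toClass⟩⟩
  · rw [← QuillenNegation.range_toClass]
    exact Set.finite_range _
  · rw [← QuillenNegation.range_toClass, ← Nat.card_coe_set_eq,
      Nat.card_range_of_injective QuillenNegation.Vertex.toClass_injective,
      Nat.card_congr QuillenNegation.Vertex.equivFin, Nat.card_fin]
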